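/- Let $D=\{z\in\mathbb C: |z|<1\}$ and let $f$ be a continuous function on $\bar D$ that is holomorphic in $D$. For $\xi\in\mathbb R$ put $$f^\#(\xi)=\int_{-1/2}^{1/2} f(e^{2\pi i x})\,e^{-2\pi i x\xi}\,dx .$$ For $z\ne 0$ write $z=re^{i\theta}$ with $r>0$, $\theta\in(-\pi,\pi]$, and set $z^\beta=r^\beta e^{i\theta\beta}$ for $\beta\in\mathbb R$. For $\alpha>0$ let $K_\alpha=\{\omega\in\mathbb C\setminus\{0\}:\omega^\alpha=1\}$, which is a finite set. Let $\alpha>0$, $\gamma\in\mathbb R$ with $\gamma<\alpha$, and $0<\lambda<1$. Suppose that $\alpha/2\notin\mathbb N$. Then the following series converge absolutely, the integrands are integrable on $[0,1]$, and $$\alpha\sum_{j=0}^\infty f^\#(\alpha j+\gamma)\lambda^{\alpha j}=\sum_{\omega\in K_\alpha}(\lambda\omega)^{-\gamma}f(\lambda\omega)-\frac{\alpha}{\pi}\int_0^1 f(-t)\,t^{\alpha-\gamma-1}\,\frac{t^\alpha\sin\gamma\pi+\lambda^\alpha\sin(\alpha-\gamma)\pi}{|t^\alpha-\lambda^\alpha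 e^{-i\alpha\pi}|^2}\,dt,\qquad(1)$$ $$\alpha\sum_{j=-\infty}^{-1} f^\#(\alpha j+\gamma)\lambda^{-\alpha j}=\frac{\alpha\lambda^\alpha}{\pi}\int_0^1 f(-t)\,t^{\alpha-\gamma-1}\,\frac{\sin(\alpha-\gamma)\pi+(\lambda t)^\alpha\sin\gamma\pi}{|e^{-i\alpha\pi}-(\lambda t)^\alpha|^2}\,dt,\qquad(2)$$ $$\alpha\sum_{j=-\infty}^{\infty} f^\#(\alpha j+\gamma)\lambda^{\alpha|j|}=\sum_{\omega\in K_\alpha}(\lambda\omega)^{-\gamma}f(\lambda\omega)-\frac{\alpha(1-\lambda^{2\alpha})}{\pi}\int_0^1 f(-t)\,t^{\alpha-\gamma-1}\,\frac{\lambda^\alpha(1-t^{2\alpha})\sin(\alpha-\gamma)\pi+t^\alpha\bigl(1-2(\lambda t)^\alpha\cos\alpha\pi+\lambda^{2\alpha}\bigr)\sin\gamma\pi}{|(t^\alpha-\lambda^\alpha e^{-i\alpha\pi})(e^{-i\alpha\pi}-(\lambda t)^\alpha)|^2}\,dt.\qquad(3)$$ If, in addition, $$\sum_{j=-\infty}^\infty|f^\#(\alpha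 j+\gamma)|<\infty,$$ then (1)–(3) are also valid for $\lambda=1$; in particular $$\alpha\sum_{j=-\infty}^\infty f^\#(\alpha j+\gamma)=\sum_{\omega\in K_\alpha}\omega^{-\gamma}f(\omega).\qquad(4)$$ When $\alpha/2\in\mathbb N$ and $\gamma=0$, all of the above (namely (1)–(3) for $0<\lambda<1$, and (1)–(4) with $\lambda=1$ under the summability condition) still holds with the integral terms of (1) and (3) and the right-hand side of (2) replaced by zero. -/

import Mathlib

namespace FractionalTaylor

noncomputable section

/-- The fractional Taylor coefficient
`f^#(ξ) = ∫_{-1/2}^{1/2} f(exp(2πix)) exp(-2πixξ) dx`. -/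
def sharp (f : ℂ → ℂ) (ξ : ℝ) : ℂ :=
  ∫ x in (-(1 / 2) : ℝ)..(1 / 2),
    f (Complex.exp (2 * Real.pi * Complex.I * x)) *
      Complex.exp (-(2 * Real.pi * Complex.I * x * ξ))

/-- `K_α = {ω : ω^α = 1}`, where `ω^α` is the principal power, i.e. the argument of `ω` is taken
in `(-π, π]`, which is Mathlib's convention for complex powers.
(For `α ≠ 0` one has `0 ^ α = 0`, so `0` does not belong to `K_α`.) -/
def K (α : ℝ) : Set ℂ := {ω | ω ^ (α : ℂ) = 1}

theorem K_finite {α : ℝ} (hα : 0 < α) : (K α).Finite := by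
  have hsub : K α ⊆ (fun n : ℤ => Complex.exp ((n * (2 * Real.pi * Complex.I)) / α)) ''
      Set.Icc (-⌈α⌉) ⌈α⌉ := by
    intro ω hω
    have hα' : (α : ℂ) ≠ 0 := by exact_mod_cast hα.ne'
    have h0 : ω ≠ 0 := by
      rintro rfl
      simp [K, Complex.zero_cpow hα'] at hω
    have h1 : Complex.exp (Complex.log ω * α) = 1 := by
      rw [← Complex.cpow_def_of_ne_zero h0]
      exact hω
    obtain ⟨n, hn⟩ := Complex.exp_eq_one_iff.1 h1
    have him := congrArg Complex.im hn
    simp [Complex.log_im] at him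
    have hpi := Real.pi_pos
    have h2 := Complex.arg_le_pi ω
    have h3 := Complex.neg_pi_lt_arg ω
    have hc := Int.le_ceil α
    have hup : (n : ℝ) ≤ ⌈α⌉ := by
      by_contra! h
      nlinarith [mul_le_mul_of_nonneg_right h2 hα.le]
    have hlo : (-⌈α⌉ : ℝ) ≤ n := by
      by_contra! h
      nlinarith [mul_le_mul_of_nonneg_right h3.le hα.le]
    refine ⟨n, ⟨by exact_mod_cast hlo, by exact_mod_cast hup⟩, ?_⟩
    change Complex.exp ((n * (2 * Real.pi * Complex.I)) / α) = ω
    rw [← hn, mul_div_cancel_right₀ _ hα', Complex.exp_log h0]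
  exact ((Set.finite_Icc _ _).image _).subset hsub

/-- The sum `∑_{ω ∈ K_α} (λω)^{-γ} f(λω)`, with principal powers. -/
def rootSum (f : ℂ → ℂ) {α : ℝ} (hα : 0 < α) (γ lam : ℝ) : ℂ :=
  ∑ ω ∈ (K_finite hα).toFinset, (lam * ω) ^ (-γ : ℂ) * f (lam * ω)

/-- `f(-t) t^{α-γ-1} (t^α sin γπ + λ^α sin (α-γ)π) / |t^α - λ^α e^{-iαπ}|²`. -/
def integrandPos (f : ℂ → ℂ) (α γ lam t : ℝ) : ℂ :=
  f (-t) * ((t ^ (α - γ - 1) *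
    ((t ^ α * Real.sin (γ * Real.pi) + lam ^ α * Real.sin ((α - γ) * Real.pi)) /
      ‖((t ^ α : ℝ) : ℂ) - (lam ^ α : ℝ) * Complex.exp (-(Complex.I * α * Real.pi))‖ ^ 2) : ℝ) : ℂ)

/-- `f(-t) t^{α-γ-1} (sin (α-γ)π + (λt)^α sin γπ) / |e^{-iαπ} - (λt)^α|²`. -/
def integrandNeg (f : ℂ → ℂ) (α γ lam t : ℝ) : ℂ :=
  f (-t) * ((t ^ (α - γ - 1) *
    ((Real.sin ((α - γ) * Real.pi) + (lam * t) ^ α * Real.sin (γ * Real.pi)) /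
      ‖Complex.exp (-(Complex.I * α * Real.pi)) - (((lam * t) ^ α : ℝ) : ℂ)‖ ^ 2) : ℝ) : ℂ)

/-- `f(-t) t^{α-γ-1} (λ^α (1-t^{2α}) sin (α-γ)π + t^α (1 - 2(λt)^α cos απ + λ^{2α}) sin γπ)`
divided by `|(t^α - λ^α e^{-iαπ})(e^{-iαπ} - (λt)^α)|²`. -/
def integrandTotal (f : ℂ → ℂ) (α γ lam t : ℝ) : ℂ :=
  f (-t) * ((t ^ (α - γ - 1) *
    ((lam ^ α * (1 - t ^ (2 * α)) * Real.sin ((α - γ) * Real.pi) +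
        t ^ α * (1 - 2 * (lam * t) ^ α * Real.cos (α * Real.pi) + lam ^ (2 * α)) *
          Real.sin (γ * Real.pi)) /
      ‖(((t ^ α : ℝ) : ℂ) - (lam ^ α : ℝ) * Complex.exp (-(Complex.I * α * Real.pi))) *
        (Complex.exp (-(Complex.I * α * Real.pi)) - (((lam * t) ^ α : ℝ) : ℂ))‖ ^ 2) : ℝ) : ℂ)

end

end FractionalTaylor

/-! Summing the geometric progression under the integral turns each one-sided series into an
integral over the unit circle of `f` times an explicit kernel. In the coordinate w = log z the disc
slit along [-1, 0] is the half-strip re w ≤ 0, |im w| ≤ π, and the circle is its right edge.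

For the indices j ≥ 0 the kernel is α e^{(α-γ)w} / (e^{αw} - λ^α). Its poles are the points log(λω),
ω ∈ K_α, with residues e^{-γp} that produce the root sum. For j < 0 the kernel is α λ^α e^{(α-γ)w} /
(1 - λ^α e^{αw}), which has no pole in the half-strip. Since γ < α, both decay as re w → -∞. On the
edges im w = ±π the function `f` takes the same values, so only the jump of the kernel survives, and
t = e^{re w} turns it into the integral over [0, 1]. This is `integral_circle_mul_eq`, fed by
`jump_pos`, `jump_neg` and `tendsto_sub_mul_kernel`.

A pole lies on the slit exactly when e^{iαπ} = 1, that is, when α/2 is a natural number; the same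
condition keeps the denominators of the integrands away from zero. The two-sided formula is the sum
of the two one-sided ones, by an algebraic identity between integrands. The value λ = 1 is reached
by dominated convergence on both sides, and there the factor 1 - λ^{2α} removes the integral.

If α is an even natural number and γ = 0, the coefficients are Taylor coefficients: those of
negative index vanish, and averaging the Taylor series over the α-th roots of unity keeps the
multiples of α. -/

namespace FractionalTaylor

open Complex Set Filter Topology MeasureTheory
open scoped Real Interval

/-! ### Residue theorem for simple poles in a rectangle and in a half-strip -/

/-- The integral of `g` over the positively oriented boundary of `[a, b] × [c, d]`. -/
noncomputable def rectIntegral (g : ℂ → ℂ) (a b c d : ℝ) : ℂ :=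
  (∫ x : ℝ in a..b, g (x + c * I)) - (∫ x : ℝ in a..b, g (x + d * I)) +
    I * (∫ y : ℝ in c..d, g (b + y * I)) - I * (∫ y : ℝ in c..d, g (a + y * I))

theorem rectIntegral_eq_zero {g : ℂ → ℂ} {a b c d : ℝ} (hab : a ≤ b) (hcd : c ≤ d)
    (hc : ContinuousOn g (Icc a b ×ℂ Icc c d)) (hd : DifferentiableOn ℂ g (Ioo a b ×ℂ Ioo c d)) :
    rectIntegral g a b c d = 0 := by
  have := integral_boundary_rect_eq_zero_of_continuousOn_of_differentiableOn g ⟨a, c⟩ ⟨b, d⟩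
    (by simpa [uIcc_of_le hab, uIcc_of_le hcd] using hc)
    (by simpa [min_eq_left hab, min_eq_left hcd, max_eq_right hab, max_eq_right hcd] using hd)
  simpa [rectIntegral] using this

/-- Two functions that agree on the boundary of a rectangle have the same boundary integral. -/
theorem rectIntegral_congr {g h : ℂ → ℂ} {a b c d : ℝ} (hab : a ≤ b) (hcd : c ≤ d)
    (hgh : ∀ z ∈ (Icc a b ×ℂ Icc c d) \ (Ioo a b ×ℂ Ioo c d), g z = h z) :
    rectIntegral g a b c d = rectIntegral h a b c d := by
  have h1 : ∀ y ∈ ({c, d} : Set ℝ), ∀ x ∈ uIcc a b, g (x + y * I) = h (x + y * I) := by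
    intro y hy x hx
    rw [uIcc_of_le hab] at hx
    apply hgh
    rcases hy with rfl | rfl <;> simp [mem_reProdIm, hx.1, hx.2, hcd]
  have h2 : ∀ x ∈ ({a, b} : Set ℝ), ∀ y ∈ uIcc c d, g (x + y * I) = h (x + y * I) := by
    intro x hx y hy
    rw [uIcc_of_le hcd] at hy
    apply hgh
    rcases hx with rfl | rfl <;> simp [mem_reProdIm, hy.1, hy.2, hab]
  unfold rectIntegral
  rw [intervalIntegral.integral_congr (h1 c (by simp)), intervalIntegral.integral_congr (h1 d (by simp)),
    intervalIntegral.integral_congr (h2 a (by simp)), intervalIntegral.integral_congr (h2 b (by simp))]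

theorem intervalIntegrable_edges {g : ℂ → ℂ} {a b c d : ℝ} (hab : a ≤ b) (hcd : c ≤ d)
    (hg : ContinuousOn g ((Icc a b ×ℂ Icc c d) \ (Ioo a b ×ℂ Ioo c d))) :
    (∀ y ∈ ({c, d} : Set ℝ), IntervalIntegrable (fun x : ℝ => g (x + y * I)) volume a b) ∧
      ∀ x ∈ ({a, b} : Set ℝ), IntervalIntegrable (fun y : ℝ => g (x + y * I)) volume c d := by
  constructor
  · intro y hy
    apply ContinuousOn.intervalIntegrable
    refine hg.comp (by fun_prop) ?_
    intro x hx
    rw [uIcc_of_le hab] at hx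
    rcases hy with rfl | rfl <;> simp [mem_reProdIm, hx.1, hx.2, hcd]
  · intro x hx
    apply ContinuousOn.intervalIntegrable
    refine hg.comp (by fun_prop) ?_
    intro y hy
    rw [uIcc_of_le hcd] at hy
    rcases hx with rfl | rfl <;> simp [mem_reProdIm, hy.1, hy.2, hab]

theorem rectIntegral_add {g h : ℂ → ℂ} {a b c d : ℝ} (hab : a ≤ b) (hcd : c ≤ d)
    (hg : ContinuousOn g ((Icc a b ×ℂ Icc c d) \ (Ioo a b ×ℂ Ioo c d)))
    (hh : ContinuousOn h ((Icc a b ×ℂ Icc c d) \ (Ioo a b ×ℂ Ioo c d))) :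
    rectIntegral (fun z => g z + h z) a b c d =
      rectIntegral g a b c d + rectIntegral h a b c d := by
  obtain ⟨g1, g2⟩ := intervalIntegrable_edges hab hcd hg
  obtain ⟨h1, h2⟩ := intervalIntegrable_edges hab hcd hh
  unfold rectIntegral
  rw [intervalIntegral.integral_add (g1 c (by simp)) (h1 c (by simp)),
    intervalIntegral.integral_add (g1 d (by simp)) (h1 d (by simp)),
    intervalIntegral.integral_add (g2 a (by simp)) (h2 a (by simp)),
    intervalIntegral.integral_add (g2 b (by simp)) (h2 b (by simp))]
  ring

/-- The logarithm is a primitive of `1 / (z - p)` along segments avoiding the cut. -/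
theorem integral_inv_sub_of_slitPlane {p u v : ℂ} {a b : ℝ}
    (h : ∀ x ∈ uIcc a b, u + x * v - p ∈ slitPlane) :
    v * ∫ x : ℝ in a..b, (u + x * v - p)⁻¹ = log (u + b * v - p) - log (u + a * v - p) := by
  rw [← intervalIntegral.integral_const_mul]
  apply intervalIntegral.integral_eq_sub_of_hasDerivAt (f := fun x : ℝ => log (u + x * v - p))
  · intro x hx
    have h1 : HasDerivAt (fun x : ℝ => u + x * v - p) v x := by
      simpa using (((hasDerivAt_id x).ofReal_comp.mul_const v).const_add u).sub_const p
    simpa [div_eq_mul_inv, mul_comm] using h1.clog_real (h x hx)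
  · apply ContinuousOn.intervalIntegrable
    apply ContinuousOn.mul continuousOn_const
    apply ContinuousOn.inv₀ (by fun_prop)
    intro x hx
    exact slitPlane_ne_zero (h x hx)

/-- The bottom, right and top edges, translated by -p, avoid the cut of `log`; the left edge crosses
it, so log(p - z) serves as primitive there. At the two left corners the primitives differ by πi
with opposite signs, which adds up to 2πi. -/
theorem rectIntegral_inv_sub {p : ℂ} {a b c d : ℝ} (hp : p ∈ Ioo a b ×ℂ Ioo c d) :
    rectIntegral (fun z => (z - p)⁻¹) a b c d = 2 * π * I := by
  obtain ⟨⟨hp1, hp2⟩, hp3, hp4⟩ := hp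
  have hbot := integral_inv_sub_of_slitPlane (p := p) (u := c * I) (v := 1) (a := a) (b := b)
    (fun x _ => Or.inr (by simp; linarith))
  have htop := integral_inv_sub_of_slitPlane (p := p) (u := d * I) (v := 1) (a := a) (b := b)
    (fun x _ => Or.inr (by simp; linarith))
  have hright := integral_inv_sub_of_slitPlane (p := p) (u := b) (v := I) (a := c) (b := d)
    (fun x _ => Or.inl (by simpa using hp2))
  have hleft := integral_inv_sub_of_slitPlane (p := -p) (u := -a) (v := -I) (a := c) (b := d)
    (fun x _ => Or.inl (by simp; linarith))
  have hleft' : I * ∫ y : ℝ in c..d, (a + y * I - p)⁻¹ =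
      -I * ∫ y : ℝ in c..d, (-a + y * -I - -p)⁻¹ := by
    rw [neg_mul, ← mul_neg, ← intervalIntegral.integral_neg]
    congr 2 with y
    rw [← inv_neg]
    congr 1
    ring
  have e1 : log (-a + d * -I - -p) = log (a + d * I - p) - π * I := by
    have : (-a + d * -I - -p : ℂ) = -(a + d * I - p) := by ring
    rw [this, log, log, norm_neg, arg_neg_eq_arg_sub_pi_of_im_pos (by simp; linarith)]
    push_cast
    ring
  have e2 : log (-a + c * -I - -p) = log (a + c * I - p) + π * I := by
    have : (-a + c * -I - -p : ℂ) = -(a + c * I - p) := by ring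
    rw [this, log, log, norm_neg, arg_neg_eq_arg_add_pi_of_im_neg (by simp; linarith)]
    push_cast
    ring
  rw [e1, e2] at hleft
  simp only [one_mul, mul_one] at hbot htop
  have f1 : ∀ y : ℝ, ∫ x : ℝ in a..b, ((x : ℂ) + y * I - p)⁻¹ =
      ∫ x : ℝ in a..b, (y * I + (x : ℂ) - p)⁻¹ := by
    intro y
    congr 1 with x
    rw [add_comm (x : ℂ)]
  unfold rectIntegral
  rw [f1, f1, hbot, htop, hright, hleft', hleft]
  rw [add_comm (d * I) (b : ℂ), add_comm (c * I) (b : ℂ), add_comm (d * I) (a : ℂ),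
    add_comm (c * I) (a : ℂ)]
  ring

theorem rectIntegral_const_mul (k : ℂ) (g : ℂ → ℂ) (a b c d : ℝ) :
    rectIntegral (fun z => k * g z) a b c d = k * rectIntegral g a b c d := by
  simp only [rectIntegral, intervalIntegral.integral_const_mul]
  ring

/-- **Residue theorem** for finitely many simple poles inside a rectangle. -/
theorem rectIntegral_eq_sum_residues {a b c d : ℝ} (hab : a ≤ b) (hcd : c ≤ d) (r : ℂ → ℂ)
    (S : Finset ℂ) : ∀ (g : ℂ → ℂ), (↑S ⊆ Ioo a b ×ℂ Ioo c d) →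
    ContinuousOn g ((Icc a b ×ℂ Icc c d) \ S) → DifferentiableOn ℂ g ((Ioo a b ×ℂ Ioo c d) \ S) →
    (∀ p ∈ S, Tendsto (fun z => (z - p) * g z) (𝓝[≠] p) (𝓝 (r p))) →
    rectIntegral g a b c d = 2 * π * I * ∑ p ∈ S, r p := by
  -- The induction keeps `g` general, because removing a pole changes the function.
  induction S using Finset.induction_on with
  | empty =>
    intro g _ hc hd _
    simpa using rectIntegral_eq_zero hab hcd (by simpa using hc) (by simpa using hd)
  | insert p S hpS ih =>
    intro g hS hc hd hr
    have hpR : p ∈ Ioo a b ×ℂ Ioo c d := hS (by simp)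
    have hopen : IsOpen (Ioo a b ×ℂ Ioo c d) := isOpen_Ioo.reProdIm isOpen_Ioo
    have hU : IsOpen ((Ioo a b ×ℂ Ioo c d) \ S) := hopen.sdiff S.finite_toSet.isClosed
    have hpU : (Ioo a b ×ℂ Ioo c d) \ S ∈ 𝓝 p := hU.mem_nhds ⟨hpR, by simpa using hpS⟩
    set h : ℂ → ℂ := fun z => g z - r p * (z - p)⁻¹ with hh
    have hhd : DifferentiableOn ℂ h (((Ioo a b ×ℂ Ioo c d) \ S) \ {p}) := by
      apply DifferentiableOn.sub
      · refine hd.mono ?_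
        intro z hz
        simpa [hz.1.1] using ⟨hz.2, hz.1.2⟩
      · apply DifferentiableOn.const_mul
        apply DifferentiableOn.inv (by fun_prop)
        intro z hz
        exact sub_ne_zero.2 hz.2
    have hlim : Tendsto (fun z => (z - p) * h z) (𝓝[≠] p) (𝓝 0) := by
      have h1 := (hr p (by simp)).sub_const (r p)
      rw [sub_self] at h1
      refine h1.congr' ?_
      filter_upwards [self_mem_nhdsWithin] with z hz
      have : z - p ≠ 0 := sub_ne_zero.2 hz
      simp only [hh]
      field_simp
    -- Riemann's criterion for a removable singularity. The value `h p` carries no meaning and is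
    -- harmless, since (z - p) times a constant tends to 0.
    have ho : (fun z => h z - h p) =o[𝓝[≠] p] fun z => (z - p)⁻¹ := by
      rw [Asymptotics.isLittleO_iff_tendsto']
      · have h2 : Tendsto (fun z => (z - p) * h p) (𝓝[≠] p) (𝓝 0) := by
          have : Tendsto (fun z => (z - p) * h p) (𝓝 p) (𝓝 ((p - p) * h p)) :=
            Continuous.tendsto (by fun_prop) p
          simpa using this.mono_left nhdsWithin_le_nhds
        have h3 := hlim.sub h2
        rw [sub_zero] at h3
        refine h3.congr fun z => ?_
        rw [div_inv_eq_mul]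
        ring
      · filter_upwards [self_mem_nhdsWithin] with z hz hz0
        exact absurd (inv_eq_zero.1 hz0) (sub_ne_zero.2 hz)
    have hH := differentiableOn_update_limUnder_of_isLittleO hpU hhd ho
    set H := Function.update h p (limUnder (𝓝[≠] p) h) with hHdef
    have hHne : ∀ z, z ≠ p → H z = h z := fun z hz => Function.update_of_ne hz _ _
    have key := ih H (fun z hz => hS (by simp [Finset.mem_coe.1 hz])) ?_ hH ?_
    · have hbd : ∀ z ∈ (Icc a b ×ℂ Icc c d) \ (Ioo a b ×ℂ Ioo c d), z ≠ p := by
        rintro z hz rfl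
        exact hz.2 hpR
      have hinv : ContinuousOn (fun z => r p * (z - p)⁻¹)
          ((Icc a b ×ℂ Icc c d) \ (Ioo a b ×ℂ Ioo c d)) := by
        apply ContinuousOn.mul continuousOn_const
        apply ContinuousOn.inv₀ (by fun_prop)
        intro z hz
        exact sub_ne_zero.2 (hbd z hz)
      have hgc : ContinuousOn g ((Icc a b ×ℂ Icc c d) \ (Ioo a b ×ℂ Ioo c d)) :=
        hc.mono fun z hz => ⟨hz.1, fun hzS => hz.2 (hS hzS)⟩
      have e1 : rectIntegral g a b c d =
          rectIntegral (fun z => H z + r p * (z - p)⁻¹) a b c d := by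
        apply rectIntegral_congr hab hcd
        intro z hz
        rw [hHne z (hbd z hz)]
        simp [hh]
      rw [e1, rectIntegral_add hab hcd _ hinv, key, rectIntegral_const_mul,
        rectIntegral_inv_sub hpR, Finset.sum_insert hpS]
      · ring
      · refine (hgc.sub hinv).congr ?_
        intro z hz
        rw [hHne z (hbd z hz)]
        rfl
    · intro z hz
      by_cases hzp : z = p
      · subst hzp
        exact ((hH.differentiableAt hpU).continuousAt).continuousWithinAt
      · have h1 : ContinuousWithinAt h ((Icc a b ×ℂ Icc c d) \ ↑(insert p S)) z := by
          apply ContinuousWithinAt.sub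
          · exact hc z ⟨hz.1, by simpa [hzp] using hz.2⟩
          · apply ContinuousWithinAt.mul continuousWithinAt_const
            apply ContinuousWithinAt.inv₀
            · fun_prop
            · exact sub_ne_zero.2 hzp
        have h2 : ContinuousWithinAt h ((Icc a b ×ℂ Icc c d) \ S) z := by
          refine h1.mono_of_mem_nhdsWithin ?_
          have : ({p}ᶜ : Set ℂ) ∈ 𝓝[(Icc a b ×ℂ Icc c d) \ S] z :=
            nhdsWithin_le_nhds (isOpen_compl_singleton.mem_nhds hzp)
          filter_upwards [this, self_mem_nhdsWithin] with w hw1 hw2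
          exact ⟨hw2.1, by simpa using ⟨hw1, hw2.2⟩⟩
        refine h2.congr_of_eventuallyEq ?_ (hHne z hzp)
        filter_upwards [nhdsWithin_le_nhds (isOpen_compl_singleton.mem_nhds hzp)] with w hw
        exact hHne w hw
    · intro q hq
      have hqp : q ≠ p := by
        rintro rfl
        exact hpS hq
      have h1 : Tendsto (fun z => (z - q) * (r p * (z - p)⁻¹)) (𝓝[≠] q) (𝓝 0) := by
        have : ContinuousAt (fun z => (z - q) * (r p * (z - p)⁻¹)) q := by
          have := sub_ne_zero.2 hqp
          fun_prop (disch := assumption)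
        have h2 := this.tendsto.mono_left (nhdsWithin_le_nhds (s := {q}ᶜ))
        simpa using h2
      have h2 := (hr q (by simp [hq])).sub h1
      rw [sub_zero] at h2
      refine h2.congr' ?_
      filter_upwards [nhdsWithin_le_nhds (isOpen_compl_singleton.mem_nhds hqp)] with w hw
      rw [hHne w hw]
      simp only [hh]
      ring

/-- Residue theorem in the half-strip `{re ≤ 0, |im| ≤ π}`. -/
theorem integral_strip_eq {g : ℂ → ℂ} {r : ℂ → ℂ} {S : Finset ℂ} {L : ℂ}
    (hS : ∀ p ∈ S, p.re < 0 ∧ p.im ∈ Ioo (-π) π)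
    (hc : ContinuousOn g ((Iic 0 ×ℂ Icc (-π) π) \ S))
    (hd : DifferentiableOn ℂ g ((Iio 0 ×ℂ Ioo (-π) π) \ S))
    (hr : ∀ p ∈ S, Tendsto (fun z => (z - p) * g z) (𝓝[≠] p) (𝓝 (r p)))
    (hleft : Tendsto (fun R : ℝ => ∫ y : ℝ in -π..π, g (R + y * I)) atBot (𝓝 0))
    (hL : Tendsto (fun R : ℝ => ∫ x : ℝ in R..0, (g (x + π * I) - g (x + (-π : ℝ) * I)))
      atBot (𝓝 L)) :
    I * ∫ y : ℝ in -π..π, g (y * I) = 2 * π * I * ∑ p ∈ S, r p + L := by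
  have hpi := Real.pi_pos
  -- Once R lies to the left of all poles, the residue theorem on [R, 0] × [-π, π] makes this an
  -- exact identity; R → -∞ then removes the left edge.
  have hev : ∀ᶠ R : ℝ in atBot, I * ∫ y : ℝ in -π..π, g (y * I) =
      2 * π * I * ∑ p ∈ S, r p + (∫ x : ℝ in R..0, (g (x + π * I) - g (x + (-π : ℝ) * I))) +
        I * ∫ y : ℝ in -π..π, g (R + y * I) := by
    have h1 : ∀ᶠ R : ℝ in atBot, ∀ p ∈ S, R < p.re := by
      rw [eventually_all_finset]
      exact fun p _ => eventually_lt_atBot _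
    filter_upwards [h1, eventually_lt_atBot 0] with R hR hR0
    have hsub : (Icc R 0 ×ℂ Icc (-π) π) ⊆ Iic 0 ×ℂ Icc (-π) π := fun z hz => ⟨hz.1.2, hz.2⟩
    have hSR : (↑S : Set ℂ) ⊆ Ioo R 0 ×ℂ Ioo (-π) π := fun p hp =>
      ⟨⟨hR p hp, (hS p hp).1⟩, (hS p hp).2⟩
    have hcR := hc.mono (sdiff_subset_sdiff_left hsub)
    have key := rectIntegral_eq_sum_residues hR0.le (by linarith : -π ≤ π) r S g hSR hcR
      (hd.mono (sdiff_subset_sdiff_left fun z hz => ⟨hz.1.2, hz.2⟩)) hr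
    have hi := (intervalIntegrable_edges hR0.le (by linarith : -π ≤ π)
      (hcR.mono (sdiff_subset_sdiff_right hSR))).1
    rw [intervalIntegral.integral_sub (hi π (by simp)) (hi (-π) (by simp)), ← key]
    simp only [rectIntegral, ofReal_zero, zero_add]
    ring
  have hlim : Tendsto (fun R : ℝ => 2 * π * I * ∑ p ∈ S, r p +
      (∫ x : ℝ in R..0, (g (x + π * I) - g (x + (-π : ℝ) * I))) +
        I * ∫ y : ℝ in -π..π, g (R + y * I)) atBot (𝓝 (2 * π * I * ∑ p ∈ S, r p + L + I * 0)) :=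
    (hL.const_add _).add (hleft.const_mul I)
  rw [mul_zero, add_zero] at hlim
  exact tendsto_nhds_unique (tendsto_const_nhds.congr' hev) hlim

/-- Taking moduli forces x = 1, so απ is a multiple of 2π, and α > 0 fixes the sign. Nonvanishing of
the denominators and absence of poles on the slit both reduce to this. -/
theorem exists_nat_of_exp_eq_ofReal {α x : ℝ} (hα : 0 < α) (hx : 0 ≤ x)
    (h : exp (-(I * α * π)) = x) : ∃ m : ℕ, α / 2 = m := by
  have hn : x = 1 := by
    have h1 := congrArg norm h
    rw [norm_exp, norm_real, Real.norm_of_nonneg hx] at h1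
    simpa using h1.symm
  rw [hn, ofReal_one] at h
  obtain ⟨n, hn⟩ := exp_eq_one_iff.1 h
  have him := congrArg im hn
  simp at him
  have hαn : α = -(2 * n) := by
    have := Real.pi_pos.ne'
    apply mul_right_cancel₀ this
    linarith
  have hn0 : (n : ℝ) < 0 := by linarith
  have hn0' : n ≤ 0 := by exact_mod_cast hn0.le
  refine ⟨(-n).toNat, ?_⟩
  have : (((-n).toNat : ℤ) : ℝ) = ((-n : ℤ) : ℝ) := by rw [Int.toNat_of_nonneg (by omega)]
  push_cast at this
  rw [this, hαn]
  ring

/-! ### The integrands: integrability, limit λ → 1, and the two-sided identity -/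

section integrands

variable {Φ : ℝ → ℝ → ℂ}

theorem intervalIntegrable_rpow_mul {φ : ℝ → ℂ} {s : ℝ} (hs : -1 < s)
    (hφ : ContinuousOn φ (Icc 0 1)) :
    IntervalIntegrable (fun t : ℝ => φ t * (t ^ s : ℝ)) volume 0 1 := by
  apply IntervalIntegrable.continuousOn_mul
  · have h := intervalIntegral.intervalIntegrable_rpow' (a := 0) (b := 1) hs
    exact ⟨h.1.ofReal, h.2.ofReal⟩
  · rwa [uIcc_of_le zero_le_one]

theorem tendsto_integral_rpow_mul {s : ℝ} (hs : -1 < s)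
    (hΦ : ContinuousOn (Function.uncurry Φ) (Ioc 0 1 ×ˢ Icc 0 1)) :
    Tendsto (fun l => ∫ t in (0 : ℝ)..1, Φ l t * (t ^ s : ℝ)) (𝓝[<] 1)
      (𝓝 (∫ t in (0 : ℝ)..1, Φ 1 t * (t ^ s : ℝ))) := by
  -- Only l near 1 matters; cutting at 1/2 gives a compact set, on which `Φ` is bounded. The
  -- dominating function is then C t^s, integrable since s > -1.
  have hsub : Icc (1 / 2 : ℝ) 1 ×ˢ Icc (0 : ℝ) 1 ⊆ Ioc 0 1 ×ˢ Icc 0 1 :=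
    prod_mono (fun x hx => ⟨by linarith [hx.1], hx.2⟩) subset_rfl
  obtain ⟨C, hC⟩ := (isCompact_Icc.prod isCompact_Icc).exists_bound_of_continuousOn (hΦ.mono hsub)
  have hev : ∀ᶠ l : ℝ in 𝓝[<] 1, l ∈ Ico (1 / 2 : ℝ) 1 := Ico_mem_nhdsLT (by norm_num)
  have hslice : ∀ l ∈ Ioc (0 : ℝ) 1, ContinuousOn (Φ l) (Icc 0 1) := fun l hl =>
    hΦ.comp (f := fun t => (l, t)) (by fun_prop) fun t ht => ⟨hl, ht⟩
  apply intervalIntegral.tendsto_integral_filter_of_dominated_convergence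
    (fun t : ℝ => C * t ^ s)
  · filter_upwards [hev] with l hl
    have := intervalIntegrable_rpow_mul hs (hslice l ⟨by linarith [hl.1], hl.2.le⟩)
    exact this.def'.1
  · filter_upwards [hev] with l hl
    refine Eventually.of_forall fun t ht => ?_
    rw [uIoc_of_le zero_le_one] at ht
    rw [norm_mul, norm_real, Real.norm_of_nonneg (Real.rpow_nonneg ht.1.le _)]
    exact mul_le_mul_of_nonneg_right (hC (l, t) ⟨⟨hl.1, hl.2.le⟩, ht.1.le, ht.2⟩)
      (Real.rpow_nonneg ht.1.le _)
  · exact (intervalIntegral.intervalIntegrable_rpow' hs).const_mul C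
  · refine Eventually.of_forall fun t ht => ?_
    rw [uIoc_of_le zero_le_one] at ht
    apply Tendsto.mul_const
    have h1 : ContinuousWithinAt (fun l => Φ l t) (Ioc 0 1) 1 :=
      (hΦ.comp (f := fun l => (l, t)) (by fun_prop) fun l hl => ⟨hl, ht.1.le, ht.2⟩) 1 (by simp)
    refine h1.tendsto.mono_left ?_
    rw [← nhdsWithin_Ioo_eq_nhdsLT (show (0 : ℝ) < 1 by norm_num)]
    exact nhdsWithin_mono _ Ioo_subset_Ioc_self

variable {f : ℂ → ℂ} {α γ : ℝ}

/-- The factor of `integrandPos` that stays continuous at `t = 0`. -/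
noncomputable def factorPos (f : ℂ → ℂ) (α γ l t : ℝ) : ℂ :=
  f (-t) * (((t ^ α * Real.sin (γ * π) + l ^ α * Real.sin ((α - γ) * π)) /
      ‖((t ^ α : ℝ) : ℂ) - (l ^ α : ℝ) * exp (-(I * α * π))‖ ^ 2 : ℝ) : ℂ)

/-- The factor of `integrandNeg` that stays continuous at `t = 0`. -/
noncomputable def factorNeg (f : ℂ → ℂ) (α γ l t : ℝ) : ℂ :=
  f (-t) * (((Real.sin ((α - γ) * π) + (l * t) ^ α * Real.sin (γ * π)) /
      ‖exp (-(I * α * π)) - (((l * t) ^ α : ℝ) : ℂ)‖ ^ 2 : ℝ) : ℂ)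

/-- The factor of `integrandTotal` that stays continuous at `t = 0`. -/
noncomputable def factorTotal (f : ℂ → ℂ) (α γ l t : ℝ) : ℂ :=
  f (-t) * (((l ^ α * (1 - t ^ (2 * α)) * Real.sin ((α - γ) * π) +
        t ^ α * (1 - 2 * (l * t) ^ α * Real.cos (α * π) + l ^ (2 * α)) * Real.sin (γ * π)) /
      ‖(((t ^ α : ℝ) : ℂ) - (l ^ α : ℝ) * exp (-(I * α * π))) *
        (exp (-(I * α * π)) - (((l * t) ^ α : ℝ) : ℂ))‖ ^ 2 : ℝ) : ℂ)

theorem integrandPos_eq (f : ℂ → ℂ) (α γ l : ℝ) :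
    integrandPos f α γ l = fun t => factorPos f α γ l t * (t ^ (α - γ - 1) : ℝ) := by
  ext t
  simp only [integrandPos, factorPos]
  push_cast
  ring

theorem integrandNeg_eq (f : ℂ → ℂ) (α γ l : ℝ) :
    integrandNeg f α γ l = fun t => factorNeg f α γ l t * (t ^ (α - γ - 1) : ℝ) := by
  ext t
  simp only [integrandNeg, factorNeg]
  push_cast
  ring

theorem integrandTotal_eq (f : ℂ → ℂ) (α γ l : ℝ) :
    integrandTotal f α γ l = fun t => factorTotal f α γ l t * (t ^ (α - γ - 1) : ℝ) := by
  ext t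
  simp only [integrandTotal, factorTotal]
  push_cast
  ring

theorem rpow_sub_rpow_mul_exp_ne_zero (hα : 0 < α) (hα2 : ¬ ∃ m : ℕ, α / 2 = m) {l t : ℝ}
    (hl : 0 < l) (ht : 0 ≤ t) :
    ((t ^ α : ℝ) : ℂ) - (l ^ α : ℝ) * exp (-(I * α * π)) ≠ 0 := by
  intro h
  have hL : ((l ^ α : ℝ) : ℂ) ≠ 0 := ofReal_ne_zero.2 (Real.rpow_pos_of_pos hl α).ne'
  apply hα2
  apply exists_nat_of_exp_eq_ofReal hα (x := t ^ α / l ^ α) (by positivity)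
  rw [ofReal_div, eq_div_iff hL]
  linear_combination -h

theorem exp_sub_rpow_ne_zero (hα : 0 < α) (hα2 : ¬ ∃ m : ℕ, α / 2 = m) {l t : ℝ}
    (hl : 0 < l) (ht : 0 ≤ t) : exp (-(I * α * π)) - (((l * t) ^ α : ℝ) : ℂ) ≠ 0 := by
  intro h
  apply hα2
  exact exists_nat_of_exp_eq_ofReal hα (x := (l * t) ^ α) (by positivity) (sub_eq_zero.1 h)

theorem continuousOn_comp_neg (hfc : ContinuousOn f (Metric.closedBall 0 1)) :
    ContinuousOn (fun t : ℝ => f (-t)) (Icc 0 1) := by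
  refine hfc.comp (by fun_prop) ?_
  intro t ht
  simpa [abs_le] using ⟨by linarith [ht.1], ht.2⟩

theorem continuousOn_mul_ofReal_div (hfc : ContinuousOn f (Metric.closedBall 0 1))
    {N D : ℝ × ℝ → ℝ} (hN : Continuous N) (hD : Continuous D)
    (hD0 : ∀ p ∈ Ioc (0 : ℝ) 1 ×ˢ Icc (0 : ℝ) 1, D p ≠ 0) :
    ContinuousOn (fun p : ℝ × ℝ => f (-p.2) * ((N p / D p : ℝ) : ℂ)) (Ioc 0 1 ×ˢ Icc 0 1) := by
  apply ContinuousOn.mul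
  · exact (continuousOn_comp_neg hfc).comp (f := fun p : ℝ × ℝ => p.2) (by fun_prop) fun p hp => hp.2
  · exact continuous_ofReal.comp_continuousOn (hN.continuousOn.div hD.continuousOn hD0)

theorem continuousOn_factorPos (hfc : ContinuousOn f (Metric.closedBall 0 1)) (hα : 0 < α)
    (hα2 : ¬ ∃ m : ℕ, α / 2 = m) :
    ContinuousOn (Function.uncurry (factorPos f α γ)) (Ioc 0 1 ×ˢ Icc 0 1) := by
  have h1 : Continuous fun p : ℝ × ℝ => p.1 ^ α := by fun_prop (disch := exact hα.le)
  have h2 : Continuous fun p : ℝ × ℝ => p.2 ^ α := by fun_prop (disch := exact hα.le)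
  refine continuousOn_mul_ofReal_div hfc (by fun_prop) (by fun_prop) ?_
  rintro ⟨l, t⟩ ⟨hl, ht⟩
  exact pow_ne_zero 2 (norm_ne_zero_iff.2 (rpow_sub_rpow_mul_exp_ne_zero hα hα2 hl.1 ht.1))

theorem continuousOn_factorNeg (hfc : ContinuousOn f (Metric.closedBall 0 1)) (hα : 0 < α)
    (hα2 : ¬ ∃ m : ℕ, α / 2 = m) :
    ContinuousOn (Function.uncurry (factorNeg f α γ)) (Ioc 0 1 ×ˢ Icc 0 1) := by
  have h1 : Continuous fun p : ℝ × ℝ => (p.1 * p.2) ^ α := by fun_prop (disch := exact hα.le)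
  refine continuousOn_mul_ofReal_div hfc (by fun_prop) (by fun_prop) ?_
  rintro ⟨l, t⟩ ⟨hl, ht⟩
  exact pow_ne_zero 2 (norm_ne_zero_iff.2 (exp_sub_rpow_ne_zero hα hα2 hl.1 ht.1))

theorem continuousOn_factorTotal (hfc : ContinuousOn f (Metric.closedBall 0 1)) (hα : 0 < α)
    (hα2 : ¬ ∃ m : ℕ, α / 2 = m) :
    ContinuousOn (Function.uncurry (factorTotal f α γ)) (Ioc 0 1 ×ˢ Icc 0 1) := by
  have h1 : Continuous fun p : ℝ × ℝ => p.1 ^ α := by fun_prop (disch := exact hα.le)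
  have h2 : Continuous fun p : ℝ × ℝ => p.2 ^ α := by fun_prop (disch := exact hα.le)
  have h3 : Continuous fun p : ℝ × ℝ => (p.1 * p.2) ^ α := by fun_prop (disch := exact hα.le)
  have h4 : Continuous fun p : ℝ × ℝ => p.1 ^ (2 * α) := by
    fun_prop (disch := exact (by positivity : 0 ≤ 2 * α))
  have h5 : Continuous fun p : ℝ × ℝ => p.2 ^ (2 * α) := by
    fun_prop (disch := exact (by positivity : 0 ≤ 2 * α))
  refine continuousOn_mul_ofReal_div hfc (by fun_prop) (by fun_prop) ?_
  rintro ⟨l, t⟩ ⟨hl, ht⟩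
  exact pow_ne_zero 2 (norm_ne_zero_iff.2 (mul_ne_zero
    (rpow_sub_rpow_mul_exp_ne_zero hα hα2 hl.1 ht.1) (exp_sub_rpow_ne_zero hα hα2 hl.1 ht.1)))

theorem continuousOn_slice (hΦ : ContinuousOn (Function.uncurry Φ) (Ioc 0 1 ×ˢ Icc 0 1)) {l : ℝ}
    (hl : l ∈ Ioc (0 : ℝ) 1) : ContinuousOn (Φ l) (Icc 0 1) :=
  hΦ.comp (f := fun t => (l, t)) (by fun_prop) fun _ ht => ⟨hl, ht⟩

theorem intervalIntegrable_integrandPos (hfc : ContinuousOn f (Metric.closedBall 0 1)) (hα : 0 < α)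
    (hγ : γ < α) (hα2 : ¬ ∃ m : ℕ, α / 2 = m) {l : ℝ} (hl : l ∈ Ioc (0 : ℝ) 1) :
    IntervalIntegrable (integrandPos f α γ l) volume 0 1 := by
  rw [integrandPos_eq]
  exact intervalIntegrable_rpow_mul (by linarith)
    (continuousOn_slice (continuousOn_factorPos hfc hα hα2) hl)

theorem intervalIntegrable_integrandNeg (hfc : ContinuousOn f (Metric.closedBall 0 1)) (hα : 0 < α)
    (hγ : γ < α) (hα2 : ¬ ∃ m : ℕ, α / 2 = m) {l : ℝ} (hl : l ∈ Ioc (0 : ℝ) 1) :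
    IntervalIntegrable (integrandNeg f α γ l) volume 0 1 := by
  rw [integrandNeg_eq]
  exact intervalIntegrable_rpow_mul (by linarith)
    (continuousOn_slice (continuousOn_factorNeg hfc hα hα2) hl)

theorem intervalIntegrable_integrandTotal (hfc : ContinuousOn f (Metric.closedBall 0 1))
    (hα : 0 < α) (hγ : γ < α) (hα2 : ¬ ∃ m : ℕ, α / 2 = m) {l : ℝ} (hl : l ∈ Ioc (0 : ℝ) 1) :
    IntervalIntegrable (integrandTotal f α γ l) volume 0 1 := by
  rw [integrandTotal_eq]
  exact intervalIntegrable_rpow_mul (by linarith)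
    (continuousOn_slice (continuousOn_factorTotal hfc hα hα2) hl)

theorem exp_neg_I_mul_pi (α : ℝ) :
    exp (-(I * α * π)) = (Real.cos (α * π) : ℂ) - Real.sin (α * π) * I := by
  have : -(I * α * π) = ((-(α * π) : ℝ) : ℂ) * I := by push_cast; ring
  rw [this, exp_mul_I, ← ofReal_cos, ← ofReal_sin, Real.cos_neg, Real.sin_neg]
  push_cast
  ring

theorem norm_sub_mul_exp_sq (α T L : ℝ) :
    ‖(T : ℂ) - L * exp (-(I * α * π))‖ ^ 2 = T ^ 2 + L ^ 2 - 2 * T * L * Real.cos (α * π) := by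
  rw [exp_neg_I_mul_pi, ← normSq_eq_norm_sq, normSq_apply]
  simp only [sub_re, sub_im, mul_re, mul_im, ofReal_re, ofReal_im, I_re, I_im]
  linear_combination L ^ 2 * Real.sin_sq_add_cos_sq (α * π)

theorem norm_exp_sub_sq (α T : ℝ) :
    ‖exp (-(I * α * π)) - (T : ℂ)‖ ^ 2 = 1 + T ^ 2 - 2 * T * Real.cos (α * π) := by
  have := norm_sub_mul_exp_sq α T 1
  rw [norm_sub_rev]
  rw [ofReal_one, one_mul] at this
  rw [this]
  ring

/-- Once the squared norms are expanded by the law of cosines, this is a polynomial identity after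
clearing denominators. No relation among cos απ, sin γπ and sin (α-γ)π is needed. -/
theorem integrandPos_sub_integrandNeg (f : ℂ → ℂ) (hα : 0 < α) (hα2 : ¬ ∃ m : ℕ, α / 2 = m)
    {l t : ℝ} (hl : 0 < l) (ht : 0 ≤ t) :
    integrandPos f α γ l t - ((l ^ α : ℝ) : ℂ) * integrandNeg f α γ l t =
      ((1 - l ^ (2 * α) : ℝ) : ℂ) * integrandTotal f α γ l t := by
  have hP := pow_ne_zero 2 (norm_ne_zero_iff.2 (rpow_sub_rpow_mul_exp_ne_zero hα hα2 hl ht))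
  have hQ := pow_ne_zero 2 (norm_ne_zero_iff.2 (exp_sub_rpow_ne_zero hα hα2 hl ht))
  have e1 : ∀ x : ℝ, 0 ≤ x → x ^ (2 * α) = (x ^ α) ^ 2 := fun x hx => by
    rw [mul_comm, Real.rpow_mul hx, Real.rpow_two]
  simp only [integrandPos, integrandNeg, integrandTotal, norm_mul, mul_pow, e1 l hl.le, e1 t ht]
  rw [norm_sub_mul_exp_sq] at hP ⊢
  rw [norm_exp_sub_sq] at hQ ⊢
  rw [Real.mul_rpow hl.le ht] at hQ ⊢
  generalize t ^ α = T at *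
  generalize l ^ α = L at *
  generalize Real.cos (α * π) = C at *
  generalize Real.sin (γ * π) = G at *
  generalize Real.sin ((α - γ) * π) = A at *
  generalize t ^ (α - γ - 1) = W at *
  have key : W * ((T * G + L * A) / (T ^ 2 + L ^ 2 - 2 * T * L * C)) -
      L * (W * ((A + L * T * G) / (1 + (L * T) ^ 2 - 2 * (L * T) * C))) =
      (1 - L ^ 2) * (W * ((L * (1 - T ^ 2) * A + T * (1 - 2 * (L * T) * C + L ^ 2) * G) /
        ((T ^ 2 + L ^ 2 - 2 * T * L * C) * (1 + (L * T) ^ 2 - 2 * (L * T) * C)))) := by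
    have hN : (T * G + L * A) * (1 + (L * T) ^ 2 - 2 * (L * T) * C) -
        L * (A + L * T * G) * (T ^ 2 + L ^ 2 - 2 * T * L * C) =
        (1 - L ^ 2) * (L * (1 - T ^ 2) * A + T * (1 - 2 * (L * T) * C + L ^ 2) * G) := by
      ring
    generalize L * (1 - T ^ 2) * A + T * (1 - 2 * (L * T) * C + L ^ 2) * G = N at *
    generalize T ^ 2 + L ^ 2 - 2 * T * L * C = P at *
    generalize 1 + (L * T) ^ 2 - 2 * (L * T) * C = Q at *
    field_simp
    linear_combination W * hN
  have key' := congrArg (fun x : ℝ => f (-t) * (x : ℂ)) key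
  push_cast at key' ⊢
  linear_combination key'

end integrands

/-! ### Cauchy's theorem on the slit disc -/

variable {f : ℂ → ℂ} {α γ : ℝ}

theorem hasSum_of_eq {ι : Type*} {u v : ι → ℂ} {a : ℂ} (h : HasSum v a) (huv : ∀ i, u i = v i) :
    HasSum u a := by
  rwa [funext huv]

theorem exp_mem_closedBall {w : ℂ} (hw : w.re ≤ 0) : exp w ∈ Metric.closedBall (0 : ℂ) 1 := by
  simpa [norm_exp] using hw

theorem exp_mem_ball {w : ℂ} (hw : w.re < 0) : exp w ∈ Metric.ball (0 : ℂ) 1 := by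
  simpa [norm_exp] using hw

theorem tendsto_integral_rpow_endpoint {φ : ℝ → ℂ} (hφ : IntervalIntegrable φ volume 0 1) :
    Tendsto (fun R : ℝ => ∫ t in Real.exp R..1, φ t) atBot (𝓝 (∫ t in (0 : ℝ)..1, φ t)) := by
  have h1 : ContinuousWithinAt (fun x => ∫ t in (1 : ℝ)..x, φ t) (uIcc 0 1) 0 :=
    intervalIntegral.continuousOn_primitive_interval' hφ (by simp) 0 (by simp)
  have h2 : Tendsto Real.exp atBot (𝓝[uIcc 0 1] 0) := by
    refine tendsto_nhdsWithin_iff.2 ⟨Real.tendsto_exp_atBot, ?_⟩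
    filter_upwards [eventually_le_atBot 0] with R hR
    rw [uIcc_of_le zero_le_one]
    exact ⟨(Real.exp_pos R).le, Real.exp_le_one_iff.2 hR⟩
  have h3 := (h1.tendsto.comp h2).neg
  rw [← intervalIntegral.integral_symm] at h3
  exact h3.congr fun R => (intervalIntegral.integral_symm _ _).symm

/-- Cauchy's theorem for `f(z) M(log z) dz / z` on the disc slit along `[-1, 0]`. -/
theorem integral_circle_mul_eq (hfc : ContinuousOn f (Metric.closedBall 0 1))
    (hfd : DifferentiableOn ℂ f (Metric.ball 0 1)) {M r : ℂ → ℂ} {J : ℝ → ℂ} {S : Finset ℂ}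
    {δ C : ℝ} (hδ : 0 < δ) (hS : ∀ p ∈ S, p.re < 0 ∧ p.im ∈ Ioo (-π) π)
    (hM : ∀ w : ℂ, w.re ≤ 0 → w.im ∈ Icc (-π) π → w ∉ S → DifferentiableAt ℂ M w)
    (hr : ∀ p ∈ S, Tendsto (fun w => (w - p) * M w) (𝓝[≠] p) (𝓝 (r p)))
    (hdecay : ∀ᶠ R : ℝ in atBot, ∀ y : ℝ, ‖M (R + y * I)‖ ≤ C * Real.exp (δ * R))
    (hJ : ∀ t ∈ Ioc (0 : ℝ) 1, M (Real.log t + π * I) - M (Real.log t + (-π : ℝ) * I) = t * J t)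
    (hJi : IntervalIntegrable (fun t : ℝ => f (-t) * J t) volume 0 1) :
    ∫ y : ℝ in -π..π, f (exp (y * I)) * M (y * I) =
      2 * π * ∑ p ∈ S, f (exp p) * r p - I * ∫ t in (0 : ℝ)..1, f (-t) * J t := by
  have hpi := Real.pi_pos
  obtain ⟨B, hB⟩ := (isCompact_closedBall (0 : ℂ) 1).exists_bound_of_continuousOn hfc
  have hB0 : 0 ≤ B := (norm_nonneg _).trans (hB 0 (by simp))
  have key := integral_strip_eq (g := fun w => f (exp w) * M w) (r := fun p => f (exp p) * r p)
    (L := ∫ t in (0 : ℝ)..1, f (-t) * J t) hS ?_ ?_ ?_ ?_ ?_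
  · have hI : I * I = -1 := I_mul_I
    linear_combination (-I) * key + (∫ y : ℝ in -π..π, f (exp (y * I)) * M (y * I)) * hI -
      (2 * π * ∑ p ∈ S, f (exp p) * r p) * hI
  · apply ContinuousOn.mul
    · exact hfc.comp continuous_exp.continuousOn fun w hw => exp_mem_closedBall hw.1.1
    · exact fun w hw => (hM w hw.1.1 hw.1.2 hw.2).continuousAt.continuousWithinAt
  · apply DifferentiableOn.mul
    · exact hfd.comp differentiable_exp.differentiableOn fun w hw => exp_mem_ball hw.1.1
    · exact fun w hw =>
        (hM w (le_of_lt hw.1.1) (Ioo_subset_Icc_self hw.1.2) hw.2).differentiableWithinAt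
  · intro p hp
    have h1 : ContinuousAt (fun w => f (exp w)) p :=
      ContinuousAt.comp (hfd.differentiableAt
        (Metric.isOpen_ball.mem_nhds (exp_mem_ball (hS p hp).1))).continuousAt
        continuous_exp.continuousAt
    refine ((h1.tendsto.mono_left nhdsWithin_le_nhds).mul (hr p hp)).congr fun w => ?_
    ring
  -- Left edge: `f` is bounded by B on the closed disc, and the kernel decays like e^{δR}.
  · have hbd : ∀ᶠ R : ℝ in atBot, ‖∫ y : ℝ in -π..π, f (exp (R + y * I)) * M (R + y * I)‖ ≤
        B * (C * Real.exp (δ * R)) * |π - -π| := by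
      filter_upwards [hdecay, eventually_le_atBot 0] with R hR hR0
      apply intervalIntegral.norm_integral_le_of_norm_le_const
      intro y _
      rw [norm_mul]
      exact mul_le_mul (hB _ (exp_mem_closedBall (by simpa using hR0))) (hR y) (norm_nonneg _) hB0
    refine squeeze_zero_norm' hbd ?_
    have h1 : Tendsto (fun R : ℝ => Real.exp (δ * R)) atBot (𝓝 0) :=
      Real.tendsto_exp_atBot.comp (tendsto_id.const_mul_atBot hδ)
    have := ((h1.const_mul C).const_mul B).mul_const |π - -π|
    simpa using this
  -- Horizontal edges: e^{x ± πi} = -e^x, so `f` factors out of the jump of `M`. With t = e^x, dx =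
  -- dt/t cancels the factor t in `hJ`.
  · refine (tendsto_integral_rpow_endpoint hJi).congr' ?_
    filter_upwards [eventually_le_atBot 0] with R hR
    have h1 := intervalIntegral.integral_deriv_smul_comp_of_deriv_nonneg (a := R) (b := 0)
      (f := Real.exp) (f' := Real.exp) (g := fun t : ℝ => f (-t) * J t)
      Real.continuous_exp.continuousOn (fun x _ => Real.hasDerivAt_exp x)
      (fun x _ => (Real.exp_pos x).le)
    rw [Real.exp_zero] at h1
    rw [← h1]
    apply intervalIntegral.integral_congr
    intro x hx
    rw [uIcc_of_le hR] at hx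
    have h2 := hJ (Real.exp x) ⟨Real.exp_pos x, Real.exp_le_one_iff.2 hx.2⟩
    rw [Real.log_exp] at h2
    have e1 : exp (x + π * I) = -(Real.exp x : ℂ) := by
      rw [exp_add, exp_pi_mul_I, ofReal_exp]
      ring
    have e2 : exp (x + (-π : ℝ) * I) = -(Real.exp x : ℂ) := by
      rw [exp_add, ofReal_neg, neg_mul, exp_neg, exp_pi_mul_I, ofReal_exp]
      norm_num
    simp only [e1, e2, Function.comp_apply, real_smul]
    linear_combination (-f (-(Real.exp x : ℂ))) * h2

/-! ### The series as circle integrals -/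

theorem sharp_eq (f : ℂ → ℂ) (ξ : ℝ) :
    sharp f ξ = (2 * π : ℂ)⁻¹ * ∫ y : ℝ in -π..π, f (exp (y * I)) * exp (-(ξ * (y * I))) := by
  have h := intervalIntegral.integral_comp_mul_left (a := -(1 / 2)) (b := 1 / 2)
    (fun y : ℝ => f (exp (y * I)) * exp (-(ξ * (y * I)))) (c := 2 * π) (by positivity)
  rw [show 2 * π * -(1 / 2) = -π by ring, show 2 * π * (1 / 2) = π by ring] at h
  rw [real_smul] at h
  push_cast at h
  rw [← h]
  unfold sharp
  congr 1 with x
  congr 2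
  · congr 1
    ring
  · ring

/-- Summation of a geometric progression of fractional Taylor coefficients under the integral. -/
theorem hasSum_pow_mul_sharp (hfc : ContinuousOn f (Metric.closedBall 0 1)) {ρ : ℝ} (hρ0 : 0 ≤ ρ)
    (hρ1 : ρ < 1) (β κ : ℝ) :
    HasSum (fun n : ℕ => (ρ : ℂ) ^ n * sharp f (κ * n + β))
      ((2 * π : ℂ)⁻¹ * ∫ y : ℝ in -π..π, f (exp (y * I)) *
        (exp (-(β * (y * I))) * (1 - ρ * exp (-(κ * (y * I))))⁻¹)) := by
  obtain ⟨B, hB⟩ := (isCompact_closedBall (0 : ℂ) 1).exists_bound_of_continuousOn hfc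
  have hfc' : Continuous fun y : ℝ => f (exp (y * I)) := by
    rw [← continuousOn_univ]
    exact hfc.comp (by fun_prop) fun y _ => exp_mem_closedBall (by simp)
  have hn : ∀ a y : ℝ, ‖exp (-(a * (y * I)))‖ = 1 := by
    intro a y
    rw [norm_exp]
    simp
  have h := intervalIntegral.hasSum_integral_of_dominated_convergence (a := -π) (b := π)
    (μ := volume) (F := fun (n : ℕ) (y : ℝ) => f (exp (y * I)) *
      (exp (-(β * (y * I))) * (ρ * exp (-(κ * (y * I)))) ^ n))
    (f := fun y : ℝ => f (exp (y * I)) *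
      (exp (-(β * (y * I))) * (1 - ρ * exp (-(κ * (y * I))))⁻¹))
    (fun n _ => B * ρ ^ n) ?_ ?_ ?_ ?_ ?_
  · refine hasSum_of_eq (h.mul_left (2 * π : ℂ)⁻¹) fun n => ?_
    rw [sharp_eq, mul_left_comm, ← intervalIntegral.integral_const_mul]
    congr 2 with y
    rw [mul_pow, ← exp_nat_mul]
    have : exp (-(((κ * n + β : ℝ) : ℂ) * (y * I))) =
        exp (-(β * (y * I))) * exp (n * -(κ * (y * I))) := by
      rw [← exp_add]
      congr 1
      push_cast
      ring
    rw [this]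
    ring
  · intro n
    exact (hfc'.mul (by fun_prop)).aestronglyMeasurable
  · intro n
    refine Eventually.of_forall fun y _ => ?_
    rw [norm_mul, norm_mul, hn, one_mul, norm_pow, norm_mul, hn, mul_one, norm_real,
      Real.norm_of_nonneg hρ0]
    exact mul_le_mul_of_nonneg_right (hB _ (exp_mem_closedBall (by simp))) (by positivity)
  · exact Eventually.of_forall fun y _ => (summable_geometric_of_lt_one hρ0 hρ1).mul_left B
  · exact continuous_const.intervalIntegrable _ _
  · refine Eventually.of_forall fun y _ => ?_
    apply HasSum.mul_left
    apply HasSum.mul_left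
    apply hasSum_geometric_of_norm_lt_one
    rw [norm_mul, hn, mul_one, norm_real, Real.norm_of_nonneg hρ0]
    exact hρ1

/-! ### Jumps and poles of the two kernels -/

variable {l : ℝ}

theorem exp_mul_log_add_pi {t : ℝ} (ht : 0 < t) (a : ℝ) :
    exp (a * (Real.log t + π * I)) =
      (t ^ a : ℝ) * ((Real.cos (a * π) : ℂ) + Real.sin (a * π) * I) := by
  have : (a * (Real.log t + π * I) : ℂ) = ((Real.log t * a : ℝ) : ℂ) + ((a * π : ℝ) : ℂ) * I := by
    push_cast; ring
  rw [this, exp_add, exp_mul_I, ← ofReal_exp, ← Real.rpow_def_of_pos ht, ← ofReal_cos, ← ofReal_sin]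

theorem exp_mul_log_sub_pi {t : ℝ} (ht : 0 < t) (a : ℝ) :
    exp (a * (Real.log t + (-π : ℝ) * I)) =
      (t ^ a : ℝ) * ((Real.cos (a * π) : ℂ) - Real.sin (a * π) * I) := by
  have : (a * (Real.log t + (-π : ℝ) * I) : ℂ) =
      ((Real.log t * a : ℝ) : ℂ) + ((-(a * π) : ℝ) : ℂ) * I := by
    push_cast; ring
  rw [this, exp_add, exp_mul_I, ← ofReal_exp, ← Real.rpow_def_of_pos ht, ← ofReal_cos, ← ofReal_sin,
    Real.cos_neg, Real.sin_neg]
  push_cast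
  ring

theorem sin_gamma_mul_pi (α γ : ℝ) : Real.sin (γ * π) =
    Real.sin (α * π) * Real.cos ((α - γ) * π) - Real.cos (α * π) * Real.sin ((α - γ) * π) := by
  rw [← Real.sin_sub]
  congr 1
  ring

theorem inv_eq_conj_mul_inv {x y p : ℂ} (h : x * y = p) (hp : p ≠ 0) : x⁻¹ = y * p⁻¹ := by
  apply inv_eq_of_mul_eq_one_right
  rw [← mul_assoc, h, mul_inv_cancel₀ hp]

/-- The values on the two edges are complex conjugates, so the jump is 2i times an imaginary part.
Its numerator comes from Im(e^{i(α-γ)π}(t^α e^{-iαπ} - l^α)) = -(t^α sin γπ + l^α sin (α-γ)π). -/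
theorem jump_pos (hα : 0 < α) (hα2 : ¬ ∃ m : ℕ, α / 2 = m) (hl : 0 < l) {t : ℝ} (ht : 0 < t) :
    α * exp ((α - γ : ℝ) * (Real.log t + π * I)) *
        (exp (α * (Real.log t + π * I)) - (l ^ α : ℝ))⁻¹ -
      α * exp ((α - γ : ℝ) * (Real.log t + (-π : ℝ) * I)) *
        (exp (α * (Real.log t + (-π : ℝ) * I)) - (l ^ α : ℝ))⁻¹ =
      t * (-(2 * I * α) * ((t ^ (α - γ - 1) *
        ((t ^ α * Real.sin (γ * π) + l ^ α * Real.sin ((α - γ) * π)) /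
          ‖((t ^ α : ℝ) : ℂ) - (l ^ α : ℝ) * exp (-(I * α * π))‖ ^ 2) : ℝ) : ℂ)) := by
  have hP := pow_ne_zero 2 (norm_ne_zero_iff.2 (rpow_sub_rpow_mul_exp_ne_zero hα hα2 hl ht.le))
  have hw : t ^ (α - γ) = t * t ^ (α - γ - 1) := by
    rw [Real.rpow_sub_one ht.ne']
    field_simp
  simp only [exp_mul_log_add_pi ht, exp_mul_log_sub_pi ht]
  rw [norm_sub_mul_exp_sq] at hP ⊢
  rw [hw, sin_gamma_mul_pi α γ]
  have hCS := Real.sin_sq_add_cos_sq (α * π)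
  generalize t ^ α = T at *
  generalize l ^ α = L at *
  generalize Real.cos (α * π) = C at *
  generalize Real.sin (α * π) = S at *
  generalize Real.sin ((α - γ) * π) = A at *
  generalize Real.cos ((α - γ) * π) = B at *
  generalize t ^ (α - γ - 1) = W at *
  have hCS' : (S : ℂ) ^ 2 + (C : ℂ) ^ 2 = 1 := by exact_mod_cast hCS
  have hP' : ((T : ℂ) ^ 2 + (L : ℂ) ^ 2 - 2 * T * L * C) ≠ 0 := by exact_mod_cast hP
  have hI := I_sq
  have h1 : ((T : ℂ) * (C + S * I) - L) * (T * (C - S * I) - L) =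
      (T : ℂ) ^ 2 + (L : ℂ) ^ 2 - 2 * T * L * C := by
    linear_combination (T : ℂ) ^ 2 * hCS' - (T : ℂ) ^ 2 * S ^ 2 * hI
  rw [inv_eq_conj_mul_inv h1 hP', inv_eq_conj_mul_inv ((mul_comm _ _).trans h1) hP']
  push_cast
  ring

/-- Conjugate values again; here the numerator is Im(e^{i(α-γ)π}(1 - (lt)^α e^{-iαπ})). -/
theorem jump_neg (hα : 0 < α) (hα2 : ¬ ∃ m : ℕ, α / 2 = m) (hl : 0 < l) {t : ℝ} (ht : 0 < t) :
    α * exp ((α - γ : ℝ) * (Real.log t + π * I)) *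
        (1 - (l ^ α : ℝ) * exp (α * (Real.log t + π * I)))⁻¹ -
      α * exp ((α - γ : ℝ) * (Real.log t + (-π : ℝ) * I)) *
        (1 - (l ^ α : ℝ) * exp (α * (Real.log t + (-π : ℝ) * I)))⁻¹ =
      t * ((2 * I * α) * ((t ^ (α - γ - 1) *
        ((Real.sin ((α - γ) * π) + (l * t) ^ α * Real.sin (γ * π)) /
          ‖exp (-(I * α * π)) - (((l * t) ^ α : ℝ) : ℂ)‖ ^ 2) : ℝ) : ℂ)) := by
  have hP := pow_ne_zero 2 (norm_ne_zero_iff.2 (exp_sub_rpow_ne_zero hα hα2 hl ht.le))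
  have hw : t ^ (α - γ) = t * t ^ (α - γ - 1) := by
    rw [Real.rpow_sub_one ht.ne']
    field_simp
  simp only [exp_mul_log_add_pi ht, exp_mul_log_sub_pi ht]
  rw [norm_exp_sub_sq, Real.mul_rpow hl.le ht.le] at hP
  rw [norm_exp_sub_sq, Real.mul_rpow hl.le ht.le, hw, sin_gamma_mul_pi α γ]
  have hCS := Real.sin_sq_add_cos_sq (α * π)
  generalize t ^ α = T at *
  generalize l ^ α = L at *
  generalize Real.cos (α * π) = C at *
  generalize Real.sin (α * π) = S at *
  generalize Real.sin ((α - γ) * π) = A at *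
  generalize Real.cos ((α - γ) * π) = B at *
  generalize t ^ (α - γ - 1) = W at *
  have hCS' : (S : ℂ) ^ 2 + (C : ℂ) ^ 2 = 1 := by exact_mod_cast hCS
  have hP' : (1 + ((L : ℂ) * T) ^ 2 - 2 * (L * T) * C) ≠ 0 := by exact_mod_cast hP
  have hI := I_sq
  have h1 : (1 - (L : ℂ) * (T * (C + S * I))) * (1 - L * (T * (C - S * I))) =
      1 + ((L : ℂ) * T) ^ 2 - 2 * (L * T) * C := by
    linear_combination ((L : ℂ) * T) ^ 2 * hCS' - ((L : ℂ) * T) ^ 2 * S ^ 2 * hI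
  rw [inv_eq_conj_mul_inv h1 hP', inv_eq_conj_mul_inv ((mul_comm _ _).trans h1) hP']
  push_cast
  ring

theorem exists_nat_of_exp_eq_of_im {w : ℂ} {L : ℝ} (hα : 0 < α) (hL : 0 < L)
    (hw : w.im = π ∨ w.im = -π) (h : exp (α * w) = L) : ∃ m : ℕ, α / 2 = m := by
  have hx := Real.exp_pos (α * w.re)
  have hx' : (Real.exp (α * w.re) : ℂ) ≠ 0 := ofReal_ne_zero.2 hx.ne'
  have hL' : (L : ℂ) ≠ 0 := ofReal_ne_zero.2 hL.ne'
  rcases hw with hw | hw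
  · apply exists_nat_of_exp_eq_ofReal hα (x := Real.exp (α * w.re) / L) (by positivity)
    rw [ofReal_div, eq_div_iff hL', ← h, ← exp_add, ofReal_exp]
    congr 1
    apply Complex.ext <;> simp [hw]
  · apply exists_nat_of_exp_eq_ofReal hα (x := L / Real.exp (α * w.re)) (by positivity)
    rw [ofReal_div, eq_div_iff hx', ← h, ofReal_exp, ← exp_add]
    congr 1
    apply Complex.ext <;> simp [hw]

theorem ne_zero_of_mem_K (hα : 0 < α) {ω : ℂ} (hω : ω ∈ K α) : ω ≠ 0 := by
  rintro rfl
  have : (α : ℂ) ≠ 0 := ofReal_ne_zero.2 hα.ne'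
  simp [K, zero_cpow this] at hω

theorem exp_log_mul_of_mem_K (hα : 0 < α) {ω : ℂ} (hω : ω ∈ K α) : exp (log ω * α) = 1 := by
  rw [← cpow_def_of_ne_zero (ne_zero_of_mem_K hα hω)]
  exact hω

theorem norm_of_mem_K (hα : 0 < α) {ω : ℂ} (hω : ω ∈ K α) : ‖ω‖ = 1 := by
  have h := congrArg norm (exp_log_mul_of_mem_K hα hω)
  rw [norm_exp, norm_one, Real.exp_eq_one_iff] at h
  simp only [mul_re, ofReal_re, ofReal_im, mul_zero, sub_zero, log_re] at h
  have h2 := (mul_eq_zero.1 h).resolve_right hα.ne'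
  have h0 := norm_pos_iff.2 (ne_zero_of_mem_K hα hω)
  exact Real.eq_one_of_pos_of_log_eq_zero h0 h2

theorem exp_mul_log_real {l : ℝ} (hl : 0 < l) (α : ℝ) :
    exp (α * (Real.log l : ℂ)) = (l ^ α : ℝ) := by
  rw [Real.rpow_def_of_pos hl, ofReal_exp, mul_comm]
  push_cast
  rfl

theorem exp_mul_log_of_mem_K (hα : 0 < α) (hl : 0 < l) {ω : ℂ} (hω : ω ∈ K α) :
    exp (α * log (l * ω)) = (l ^ α : ℝ) := by
  rw [log_ofReal_mul hl (ne_zero_of_mem_K hα hω), mul_add, exp_add, exp_mul_log_real hl,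
    mul_comm (α : ℂ) (log ω), exp_log_mul_of_mem_K hα hω, mul_one]

/-- Together with `exp_mul_log_of_mem_K`, this identifies all poles in the closed strip. The edge im
w = -π, outside the range of the principal logarithm, carries none because α/2 is not natural. -/
theorem eq_log_of_exp_eq (hα : 0 < α) (hα2 : ¬ ∃ m : ℕ, α / 2 = m) (hl : 0 < l) {w : ℂ}
    (hw : w.im ∈ Icc (-π) π) (h : exp (α * w) = (l ^ α : ℝ)) : ∃ ω ∈ K α, log (l * ω) = w := by
  have hL : 0 < l ^ α := Real.rpow_pos_of_pos hl α
  have h1 : -π < w.im := lt_of_le_of_ne hw.1 fun he =>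
    hα2 (exists_nat_of_exp_eq_of_im hα hL (Or.inr he.symm) h)
  refine ⟨exp (w - Real.log l), ?_, ?_⟩
  · change exp (w - Real.log l) ^ (α : ℂ) = 1
    rw [cpow_def_of_ne_zero (exp_ne_zero _), log_exp (by simpa using h1) (by simpa using hw.2),
      sub_mul, exp_sub, mul_comm w, mul_comm (Real.log l : ℂ), h, exp_mul_log_real hl,
      div_self (ofReal_ne_zero.2 hL.ne')]
  · have : (l : ℂ) = exp (Real.log l) := by rw [← ofReal_exp, Real.exp_log hl]
    nth_rewrite 1 [this]
    rw [← exp_add, add_sub_cancel, log_exp h1 hw.2]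

/-- The kernel of (1) in the logarithmic coordinate has residue `e^{-γp}` at each pole `p`. -/
theorem tendsto_sub_mul_kernel (hα : 0 < α) {p : ℂ} {L : ℝ} (hp : exp (α * p) = L) :
    Tendsto (fun w => (w - p) * (α * exp ((α - γ : ℝ) * w) * (exp (α * w) - L)⁻¹)) (𝓝[≠] p)
      (𝓝 (exp (-γ * p))) := by
  have hα' : (α : ℂ) ≠ 0 := ofReal_ne_zero.2 hα.ne'
  have hd : HasDerivAt (fun w : ℂ => exp (α * w)) (exp (α * p) * α) p := by
    simpa using ((hasDerivAt_id p).const_mul (α : ℂ)).cexp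
  have h1 := (hasDerivAt_iff_tendsto_slope.1 hd).inv₀ (mul_ne_zero (exp_ne_zero _) hα')
  have h2 : ContinuousAt (fun w : ℂ => α * exp ((α - γ : ℝ) * w)) p := by fun_prop
  have h3 := (h2.tendsto.mono_left nhdsWithin_le_nhds).mul h1
  have e : α * exp ((α - γ : ℝ) * p) * (exp (α * p) * α)⁻¹ = exp (-γ * p) := by
    have : exp ((α - γ : ℝ) * p) = exp (-γ * p) * exp (α * p) := by
      rw [← exp_add]
      congr 1
      push_cast
      ring
    rw [this]
    have := exp_ne_zero (α * p)
    field_simp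
  rw [e] at h3
  refine h3.congr fun w => ?_
  rw [slope_def_field, hp, inv_div]
  ring

/-! ### The one-sided series for λ < 1 -/

theorem hasSum_pos (hfc : ContinuousOn f (Metric.closedBall 0 1))
    (hfd : DifferentiableOn ℂ f (Metric.ball 0 1)) (hα : 0 < α) (hγ : γ < α)
    (hα2 : ¬ ∃ m : ℕ, α / 2 = m) (hl : 0 < l) (hl1 : l < 1) :
    HasSum (fun j : ℕ => (α : ℂ) * (sharp f (α * j + γ) * ((l ^ (α * j) : ℝ) : ℂ)))
      (rootSum f hα γ l - ((α / π : ℝ) : ℂ) * ∫ t in (0 : ℝ)..1, integrandPos f α γ l t) := by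
  have hpi : (π : ℂ) ≠ 0 := ofReal_ne_zero.2 Real.pi_pos.ne'
  have hL : 0 < l ^ α := Real.rpow_pos_of_pos hl α
  have hL1 : l ^ α < 1 := Real.rpow_lt_one hl.le hl1 hα
  have hsum := (hasSum_pow_mul_sharp hfc hL.le hL1 γ α).mul_left (α : ℂ)
  have key := integral_circle_mul_eq hfc hfd
    (M := fun w => α * exp ((α - γ : ℝ) * w) * (exp (α * w) - (l ^ α : ℝ))⁻¹)
    (r := fun p => exp (-γ * p))
    (J := fun t => -(2 * I * α) * ((t ^ (α - γ - 1) *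
        ((t ^ α * Real.sin (γ * π) + l ^ α * Real.sin ((α - γ) * π)) /
          ‖((t ^ α : ℝ) : ℂ) - (l ^ α : ℝ) * exp (-(I * α * π))‖ ^ 2) : ℝ) : ℂ))
    (S := (K_finite hα).toFinset.image fun ω => log (l * ω))
    -- Far to the left |e^{αw}| < l^α / 2, so the denominator has modulus at least l^α / 2.
    (δ := α - γ) (C := α * (l ^ α / 2)⁻¹) (by linarith) ?_ ?_ ?_ ?_ ?_ ?_
  · have hint : ∀ t : ℝ, f (-t) * (-(2 * I * α) * ((t ^ (α - γ - 1) *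
        ((t ^ α * Real.sin (γ * π) + l ^ α * Real.sin ((α - γ) * π)) /
          ‖((t ^ α : ℝ) : ℂ) - (l ^ α : ℝ) * exp (-(I * α * π))‖ ^ 2) : ℝ) : ℂ)) =
        -(2 * I * α) * integrandPos f α γ l t := fun t => by
      rw [integrandPos]
      ring
    simp only [hint] at key
    rw [intervalIntegral.integral_const_mul, Finset.sum_image] at key
    · have hroot : ∑ ω ∈ (K_finite hα).toFinset, f (exp (log (l * ω))) * exp (-γ * log (l * ω)) =
          rootSum f hα γ l := by
        refine Finset.sum_congr rfl fun ω hω => ?_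
        have hω0 := ne_zero_of_mem_K hα ((K_finite hα).mem_toFinset.1 hω)
        have h0 : (l : ℂ) * ω ≠ 0 := mul_ne_zero (ofReal_ne_zero.2 hl.ne') hω0
        rw [exp_log h0, cpow_def_of_ne_zero h0, mul_comm (log _)]
        ring
      rw [hroot] at key
      -- Multiplying numerator and denominator by e^{αw} turns the geometric sum into the kernel.
      have hker : ∫ y : ℝ in -π..π, f (exp (y * I)) *
          (exp (-(γ * (y * I))) * (1 - (l ^ α : ℝ) * exp (-(α * (y * I))))⁻¹) * α =
          ∫ y : ℝ in -π..π, f (exp (y * I)) *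
            (α * exp ((α - γ : ℝ) * (y * I)) * (exp (α * (y * I)) - (l ^ α : ℝ))⁻¹) := by
        congr 1 with y
        have e1 : exp ((α - γ : ℝ) * (y * I)) = exp (α * (y * I)) * exp (-(γ * (y * I))) := by
          rw [← exp_add]
          congr 1
          push_cast
          ring
        have e2 : 1 - (l ^ α : ℝ) * exp (-(α * (y * I))) =
            (exp (α * (y * I)) - (l ^ α : ℝ)) * (exp (α * (y * I)))⁻¹ := by
          rw [exp_neg, sub_mul, mul_inv_cancel₀ (exp_ne_zero _)]
        rw [e1, e2, mul_inv, inv_inv]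
        ring
      rw [intervalIntegral.integral_mul_const] at hker
      have hval : (α : ℂ) * ((2 * π : ℂ)⁻¹ * ∫ y : ℝ in -π..π, f (exp (y * I)) *
          (exp (-(γ * (y * I))) * (1 - (l ^ α : ℝ) * exp (-(α * (y * I))))⁻¹)) =
          rootSum f hα γ l -
            ((α / π : ℝ) : ℂ) * ∫ t in (0 : ℝ)..1, integrandPos f α γ l t := by
        rw [mul_left_comm, mul_comm (α : ℂ), hker, key]
        push_cast
        field_simp
        linear_combination (α * ∫ t in (0 : ℝ)..1, integrandPos f α γ l t) * I_sq
      rw [hval] at hsum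
      refine hasSum_of_eq hsum fun n => ?_
      rw [Real.rpow_mul hl.le, Real.rpow_natCast]
      push_cast
      ring
    · intro ω hω ω' hω' h
      simp only [SetLike.mem_coe, Set.Finite.mem_toFinset] at hω hω'
      have hl0 : (l : ℂ) ≠ 0 := ofReal_ne_zero.2 hl.ne'
      have h2 := congrArg exp h
      simp only at h2
      rw [exp_log (mul_ne_zero hl0 (ne_zero_of_mem_K hα hω)),
        exp_log (mul_ne_zero hl0 (ne_zero_of_mem_K hα hω'))] at h2
      exact mul_left_cancel₀ hl0 h2
  · simp only [Finset.mem_image, Set.Finite.mem_toFinset]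
    rintro p ⟨ω, hω, rfl⟩
    refine ⟨?_, neg_pi_lt_log_im _, ?_⟩
    · rw [log_re, norm_mul, norm_of_mem_K hα hω, mul_one, norm_real, Real.norm_of_nonneg hl.le]
      exact Real.log_neg hl hl1
    · refine lt_of_le_of_ne (log_im_le_pi _) fun he => hα2 ?_
      exact exists_nat_of_exp_eq_of_im hα hL (Or.inl he) (exp_mul_log_of_mem_K hα hl hω)
  · intro w _ hw2 hw3
    have : exp (α * w) - (l ^ α : ℝ) ≠ 0 := by
      intro h
      obtain ⟨ω, hω, h⟩ := eq_log_of_exp_eq hα hα2 hl hw2 (sub_eq_zero.1 h)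
      exact hw3 (Finset.mem_image.2 ⟨ω, (K_finite hα).mem_toFinset.2 hω, h⟩)
    fun_prop (disch := assumption)
  · simp only [Finset.mem_image, Set.Finite.mem_toFinset]
    rintro p ⟨ω, hω, rfl⟩
    exact tendsto_sub_mul_kernel hα (exp_mul_log_of_mem_K hα hl hω)
  · have h1 : Tendsto (fun R : ℝ => Real.exp (α * R)) atBot (𝓝 0) :=
      Real.tendsto_exp_atBot.comp (tendsto_id.const_mul_atBot hα)
    filter_upwards [h1.eventually (gt_mem_nhds (half_pos hL))] with R hR y
    have h2 : l ^ α / 2 ≤ ‖exp (α * (R + y * I)) - (l ^ α : ℝ)‖ := by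
      have h3 := norm_sub_norm_le ((l ^ α : ℝ) : ℂ) (exp (α * (R + y * I)))
      rw [norm_sub_rev, norm_real, Real.norm_of_nonneg hL.le, norm_exp] at h3
      simp only [mul_re, ofReal_re, ofReal_im, add_re, I_re, I_im, add_im, mul_im] at h3
      ring_nf at h3 hR ⊢
      linarith
    rw [norm_mul, norm_mul, norm_inv, norm_exp, norm_real, Real.norm_of_nonneg hα.le]
    have h4 : ((((α - γ : ℝ) : ℂ)) * (R + y * I)).re = (α - γ) * R := by simp
    rw [h4, mul_right_comm]
    gcongr
  · intro t ht
    exact jump_pos hα hα2 hl ht.1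
  · have := (intervalIntegrable_integrandPos hfc hα hγ hα2 ⟨hl, hl1.le⟩).const_mul (-(2 * I * α))
    refine this.congr fun t _ => ?_
    simp only [integrandPos]
    ring

theorem hasSum_neg (hfc : ContinuousOn f (Metric.closedBall 0 1))
    (hfd : DifferentiableOn ℂ f (Metric.ball 0 1)) (hα : 0 < α) (hγ : γ < α)
    (hα2 : ¬ ∃ m : ℕ, α / 2 = m) (hl : 0 < l) (hl1 : l < 1) :
    HasSum (fun n : ℕ => (α : ℂ) *
        (sharp f (α * (-(n + 1) : ℤ) + γ) * ((l ^ (-(α * (-(n + 1) : ℤ))) : ℝ) : ℂ)))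
      (((α * l ^ α / π : ℝ) : ℂ) * ∫ t in (0 : ℝ)..1, integrandNeg f α γ l t) := by
  have hL : 0 < l ^ α := Real.rpow_pos_of_pos hl α
  have hL1 : l ^ α < 1 := Real.rpow_lt_one hl.le hl1 hα
  -- The index j = -(n+1) gives αj + γ = -αn + (γ - α) and the power l^{α(n+1)}; hence the extra
  -- factor l^α.
  have hsum := (hasSum_pow_mul_sharp hfc hL.le hL1 (γ - α) (-α)).mul_left
    ((α : ℂ) * (l ^ α : ℝ))
  -- This excludes poles in the half-strip and also supplies the constant in the decay bound.
  have hbd : ∀ w : ℂ, w.re ≤ 0 → 1 - l ^ α ≤ ‖1 - (l ^ α : ℝ) * exp (α * w)‖ := by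
    intro w hw
    have h3 := norm_sub_norm_le (1 : ℂ) ((l ^ α : ℝ) * exp (α * w))
    rw [norm_one, norm_mul, norm_real, Real.norm_of_nonneg hL.le, norm_exp, re_ofReal_mul] at h3
    have h4 : Real.exp (α * w.re) ≤ 1 :=
      Real.exp_le_one_iff.2 (mul_nonpos_of_nonneg_of_nonpos hα.le hw)
    nlinarith
  have key := integral_circle_mul_eq hfc hfd
    (M := fun w => α * exp ((α - γ : ℝ) * w) * (1 - (l ^ α : ℝ) * exp (α * w))⁻¹)
    (r := fun p => 0)
    (J := fun t => (2 * I * α) * ((t ^ (α - γ - 1) *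
        ((Real.sin ((α - γ) * π) + (l * t) ^ α * Real.sin (γ * π)) /
          ‖exp (-(I * α * π)) - (((l * t) ^ α : ℝ) : ℂ)‖ ^ 2) : ℝ) : ℂ))
    (S := ∅) (δ := α - γ) (C := α * (1 - l ^ α)⁻¹) (by linarith) (by simp) ?_ (by simp) ?_ ?_ ?_
  · have hint : ∀ t : ℝ, f (-t) * ((2 * I * α) * ((t ^ (α - γ - 1) *
        ((Real.sin ((α - γ) * π) + (l * t) ^ α * Real.sin (γ * π)) /
          ‖exp (-(I * α * π)) - (((l * t) ^ α : ℝ) : ℂ)‖ ^ 2) : ℝ) : ℂ)) =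
        (2 * I * α) * integrandNeg f α γ l t := fun t => by
      rw [integrandNeg]
      ring
    simp only [hint] at key
    rw [intervalIntegral.integral_const_mul, Finset.sum_empty] at key
    have hker : ∫ y : ℝ in -π..π, f (exp (y * I)) *
        (exp (-((γ - α : ℝ) * (y * I))) *
          (1 - (l ^ α : ℝ) * exp (-((-α : ℝ) * (y * I))))⁻¹) * α =
        ∫ y : ℝ in -π..π, f (exp (y * I)) *
          (α * exp ((α - γ : ℝ) * (y * I)) * (1 - (l ^ α : ℝ) * exp (α * (y * I)))⁻¹) := by
      congr 1 with y
      have e1 : (-((γ - α : ℝ) * (y * I)) : ℂ) = (α - γ : ℝ) * (y * I) := by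
        push_cast
        ring
      have e2 : (-((-α : ℝ) * (y * I)) : ℂ) = α * (y * I) := by
        push_cast
        ring
      rw [e1, e2]
      ring
    rw [intervalIntegral.integral_mul_const] at hker
    have hval : (α : ℂ) * (l ^ α : ℝ) * ((2 * π : ℂ)⁻¹ * ∫ y : ℝ in -π..π, f (exp (y * I)) *
        (exp (-((γ - α : ℝ) * (y * I))) *
          (1 - (l ^ α : ℝ) * exp (-((-α : ℝ) * (y * I))))⁻¹)) =
        ((α * l ^ α / π : ℝ) : ℂ) * ∫ t in (0 : ℝ)..1, integrandNeg f α γ l t := by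
      have alg : ∀ X Y : ℂ, X * α = 2 * π * 0 - I * (2 * I * α * Y) →
          (α : ℂ) * (l ^ α : ℝ) * ((2 * π : ℂ)⁻¹ * X) = ((α * l ^ α / π : ℝ) : ℂ) * Y := by
        intro X Y h
        have h2 : X * α = 2 * α * Y := by linear_combination h - 2 * α * Y * I_sq
        rw [ofReal_div, ofReal_mul]
        linear_combination ((l ^ α : ℝ) : ℂ) * (2 * π : ℂ)⁻¹ * h2
      exact alg _ _ (hker.trans key)
    rw [hval] at hsum
    refine hasSum_of_eq hsum fun n => ?_
    have e1 : -(α * ((-(n + 1) : ℤ) : ℝ)) = α * ((n + 1 : ℕ) : ℝ) := by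
      push_cast
      ring
    have e2 : α * ((-(n + 1) : ℤ) : ℝ) + γ = -α * n + (γ - α) := by
      push_cast
      ring
    rw [e1, e2, Real.rpow_mul hl.le, Real.rpow_natCast, pow_succ]
    push_cast
    ring
  · intro w hw _ _
    have : 1 - (l ^ α : ℝ) * exp (α * w) ≠ 0 := norm_pos_iff.1 (by linarith [hbd w hw])
    fun_prop (disch := assumption)
  · filter_upwards [eventually_le_atBot 0] with R hR y
    have h2 := hbd (R + y * I) (by simpa using hR)
    have h3 : 0 < 1 - l ^ α := by linarith
    rw [norm_mul, norm_mul, norm_inv, norm_exp, norm_real, Real.norm_of_nonneg hα.le]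
    have h4 : ((((α - γ : ℝ) : ℂ)) * (R + y * I)).re = (α - γ) * R := by simp
    rw [h4, mul_right_comm]
    gcongr
  · intro t ht
    exact jump_neg hα hα2 hl ht.1
  · have := (intervalIntegrable_integrandNeg hfc hα hγ hα2 ⟨hl, hl1.le⟩).const_mul (2 * I * α)
    refine this.congr fun t _ => ?_
    simp only [integrandNeg]
    ring

/-! ### The boundary case λ = 1 -/

/-- An Abel limit theorem for absolutely convergent generalized power series. -/
theorem hasSum_one_of_tendsto {a : ℕ → ℂ} {e : ℕ → ℝ} {c : ℂ} {F : ℝ → ℂ} (he : ∀ n, 0 ≤ e n)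
    (ha : Summable fun n => ‖a n‖)
    (h : ∀ l : ℝ, 0 < l → l < 1 → HasSum (fun n => c * (a n * ((l ^ e n : ℝ) : ℂ))) (F l))
    (hF : Tendsto F (𝓝[<] 1) (𝓝 (F 1))) :
    HasSum (fun n => c * (a n * (((1 : ℝ) ^ e n : ℝ) : ℂ))) (F 1) := by
  have hs : Summable fun n => c * (a n * (((1 : ℝ) ^ e n : ℝ) : ℂ)) := by
    simpa using ha.of_norm.mul_left c
  have hev : ∀ᶠ l : ℝ in 𝓝[<] 1, l ∈ Ioo (0 : ℝ) 1 := Ioo_mem_nhdsLT one_pos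
  -- Since `e n` ≥ 0, l^{e n} ≤ 1, and the terms are dominated by ‖c‖ ‖a n‖.
  have ht : Tendsto (fun l : ℝ => ∑' n, c * (a n * ((l ^ e n : ℝ) : ℂ))) (𝓝[<] 1)
      (𝓝 (∑' n, c * (a n * (((1 : ℝ) ^ e n : ℝ) : ℂ)))) := by
    refine tendsto_tsum_of_dominated_convergence (ha.mul_left ‖c‖) (fun n => ?_) ?_
    · have h1 : ContinuousAt (fun l : ℝ => c * (a n * ((l ^ e n : ℝ) : ℂ))) 1 := by
        have : ContinuousAt (fun l : ℝ => l ^ e n) 1 :=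
          Real.continuousAt_rpow_const _ _ (Or.inl one_ne_zero)
        fun_prop
      exact h1.tendsto.mono_left nhdsWithin_le_nhds
    · filter_upwards [hev] with l hl n
      rw [norm_mul, norm_mul, norm_real, Real.norm_of_nonneg (Real.rpow_nonneg hl.1.le _)]
      gcongr
      exact mul_le_of_le_one_right (norm_nonneg _) (Real.rpow_le_one hl.1.le hl.2.le (he n))
  have ht' := ht.congr' (by
    filter_upwards [hev] with l hl
    exact (h l hl.1 hl.2).tsum_eq)
  rw [tendsto_nhds_unique hF ht']
  exact hs.hasSum

theorem tendsto_rootSum (hfc : ContinuousOn f (Metric.closedBall 0 1)) (hα : 0 < α) (γ : ℝ) :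
    Tendsto (rootSum f hα γ) (𝓝[<] 1) (𝓝 (rootSum f hα γ 1)) := by
  apply tendsto_finsetSum
  intro ω hω
  have hω' := (K_finite hα).mem_toFinset.1 hω
  have hω0 := ne_zero_of_mem_K hα hω'
  apply Tendsto.mul
  -- Positive scaling leaves the argument of ω unchanged, so this stays continuous in l even if ω
  -- lies on the cut of the power.
  · have h1 : ContinuousAt (fun l : ℝ => exp ((Real.log l + log ω) * (-γ : ℂ))) 1 := by
      have : ContinuousAt (fun l : ℝ => (Real.log l : ℂ)) 1 :=
        continuous_ofReal.continuousAt.comp (Real.continuousAt_log one_ne_zero)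
      fun_prop
    have h2 : ∀ l : ℝ, 0 < l → exp ((Real.log l + log ω) * (-γ : ℂ)) = (l * ω) ^ (-γ : ℂ) := by
      intro l hl
      rw [cpow_def_of_ne_zero (mul_ne_zero (ofReal_ne_zero.2 hl.ne') hω0), log_ofReal_mul hl hω0]
    rw [← h2 1 one_pos]
    refine (h1.tendsto.mono_left nhdsWithin_le_nhds).congr' ?_
    filter_upwards [Ioo_mem_nhdsLT (show (0 : ℝ) < 1 from one_pos)] with l hl
    exact h2 l hl.1
  · have h1 : ContinuousWithinAt (fun l : ℝ => f (l * ω)) (Icc 0 1) 1 := by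
      refine (hfc.comp (f := fun l : ℝ => (l : ℂ) * ω) (by fun_prop) ?_) 1 (by simp)
      intro l hl
      rw [mem_closedBall_zero_iff, norm_mul, norm_of_mem_K hα hω', mul_one, norm_real,
        Real.norm_of_nonneg hl.1]
      exact hl.2
    refine h1.tendsto.mono_left ?_
    rw [← nhdsWithin_Ioo_eq_nhdsLT (show (0 : ℝ) < 1 from one_pos)]
    exact nhdsWithin_mono _ Ioo_subset_Icc_self

/-- `n ↦ -(n + 1)` as an equivalence onto the integers `≤ -1`. -/
def natEquivLeNegOne : ℕ ≃ {j : ℤ // j ≤ -1} where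
  toFun n := ⟨-(n + 1), by omega⟩
  invFun j := (-(j : ℤ) - 1).toNat
  left_inv n := by simp
  right_inv j := by
    have := j.2
    ext
    simp only
    omega

theorem hasSum_le_neg_one_iff {u : ℤ → ℂ} {a : ℂ} :
    HasSum (fun n : ℕ => u (-(n + 1))) a ↔ HasSum (fun j : {j : ℤ // j ≤ -1} => u j) a :=
  natEquivLeNegOne.hasSum_iff (f := fun j : {j : ℤ // j ≤ -1} => u j)

theorem hasSum_pos_one (hfc : ContinuousOn f (Metric.closedBall 0 1))
    (hfd : DifferentiableOn ℂ f (Metric.ball 0 1)) (hα : 0 < α) (hγ : γ < α)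
    (hα2 : ¬ ∃ m : ℕ, α / 2 = m) (hs : Summable fun j : ℤ => ‖sharp f (α * j + γ)‖) :
    HasSum (fun j : ℕ => (α : ℂ) * (sharp f (α * j + γ) * (((1 : ℝ) ^ (α * j) : ℝ) : ℂ)))
      (rootSum f hα γ 1 - ((α / π : ℝ) : ℂ) * ∫ t in (0 : ℝ)..1, integrandPos f α γ 1 t) := by
  refine hasSum_one_of_tendsto (a := fun j : ℕ => sharp f (α * j + γ)) (e := fun j => α * j)
    (F := fun l => rootSum f hα γ l -
      ((α / π : ℝ) : ℂ) * ∫ t in (0 : ℝ)..1, integrandPos f α γ l t)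
    (fun n => by positivity) ?_ (fun l hl hl1 => hasSum_pos hfc hfd hα hγ hα2 hl hl1) ?_
  · simpa [Function.comp_def] using hs.comp_injective (i := ((↑) : ℕ → ℤ)) Nat.cast_injective
  · simp only [integrandPos_eq]
    exact (tendsto_rootSum hfc hα γ).sub ((tendsto_integral_rpow_mul (by linarith)
      (continuousOn_factorPos hfc hα hα2)).const_mul _)

theorem hasSum_neg_one (hfc : ContinuousOn f (Metric.closedBall 0 1))
    (hfd : DifferentiableOn ℂ f (Metric.ball 0 1)) (hα : 0 < α) (hγ : γ < α)
    (hα2 : ¬ ∃ m : ℕ, α / 2 = m) (hs : Summable fun j : ℤ => ‖sharp f (α * j + γ)‖) :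
    HasSum (fun n : ℕ => (α : ℂ) *
        (sharp f (α * (-(n + 1) : ℤ) + γ) * (((1 : ℝ) ^ (-(α * (-(n + 1) : ℤ))) : ℝ) : ℂ)))
      (((α * (1 : ℝ) ^ α / π : ℝ) : ℂ) * ∫ t in (0 : ℝ)..1, integrandNeg f α γ 1 t) := by
  refine hasSum_one_of_tendsto (a := fun n : ℕ => sharp f (α * (-(n + 1) : ℤ) + γ))
    (e := fun n : ℕ => -(α * (-(n + 1) : ℤ)))
    (F := fun l => ((α * l ^ α / π : ℝ) : ℂ) * ∫ t in (0 : ℝ)..1, integrandNeg f α γ l t)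
    (fun n => ?_) ?_ (fun l hl hl1 => hasSum_neg hfc hfd hα hγ hα2 hl hl1) ?_
  · push_cast
    have : 0 ≤ α * ((n : ℝ) + 1) := by positivity
    linarith
  · exact hs.comp_injective (i := fun n : ℕ => (-(n + 1) : ℤ)) fun a b h => by
      simpa using h
  · simp only [integrandNeg_eq]
    apply Tendsto.mul
    · have h1 : ContinuousAt (fun l : ℝ => ((α * l ^ α / π : ℝ) : ℂ)) 1 := by
        have : ContinuousAt (fun l : ℝ => l ^ α) 1 :=
          Real.continuousAt_rpow_const _ _ (Or.inl one_ne_zero)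
        have hc : ContinuousAt (fun l : ℝ => α * l ^ α / π) 1 := by fun_prop
        exact continuous_ofReal.continuousAt.comp hc
      exact h1.tendsto.mono_left nhdsWithin_le_nhds
    · exact tendsto_integral_rpow_mul (by linarith) (continuousOn_factorNeg hfc hα hα2)

/-! ### Assembling the two-sided series -/

theorem integral_integrandTotal (hfc : ContinuousOn f (Metric.closedBall 0 1)) (hα : 0 < α)
    (hγ : γ < α) (hα2 : ¬ ∃ m : ℕ, α / 2 = m) (hl : l ∈ Ioc (0 : ℝ) 1) :
    (∫ t in (0 : ℝ)..1, integrandPos f α γ l t) -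
        ((l ^ α : ℝ) : ℂ) * ∫ t in (0 : ℝ)..1, integrandNeg f α γ l t =
      ((1 - l ^ (2 * α) : ℝ) : ℂ) * ∫ t in (0 : ℝ)..1, integrandTotal f α γ l t := by
  rw [← intervalIntegral.integral_const_mul, ← intervalIntegral.integral_const_mul,
    ← intervalIntegral.integral_sub (intervalIntegrable_integrandPos hfc hα hγ hα2 hl)
      ((intervalIntegrable_integrandNeg hfc hα hγ hα2 hl).const_mul _)]
  apply intervalIntegral.integral_congr
  intro t ht
  rw [uIcc_of_le zero_le_one] at ht
  exact integrandPos_sub_integrandNeg f hα hα2 hl.1 ht.1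

/-- A two-sided sum from its nonnegative and its negative part. -/
theorem hasSum_abs {s : ℤ → ℂ} {c a b : ℂ}
    (hp : HasSum (fun j : ℕ => c * (s j * ((l ^ (α * j) : ℝ) : ℂ))) a)
    (hn : HasSum (fun n : ℕ => c * (s (-(n + 1)) * ((l ^ (-(α * (-(n + 1) : ℤ))) : ℝ) : ℂ))) b) :
    HasSum (fun j : ℤ => c * (s j * ((l ^ (α * |(j : ℝ)|) : ℝ) : ℂ))) (a + b) := by
  apply HasSum.of_nat_of_neg_add_one
  · refine hasSum_of_eq hp fun n => ?_
    simp
  · refine hasSum_of_eq hn fun n => ?_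
    have : |((-(n + 1) : ℤ) : ℝ)| = -((-(n + 1) : ℤ) : ℝ) := by
      apply abs_of_nonpos
      push_cast
      have : (0 : ℝ) ≤ n := by positivity
      linarith
    rw [this, mul_neg]

/-! ### Natural exponents with γ = 0 -/

/-- If `α` is a positive integer, the coefficients of negative index vanish. -/
theorem sharp_eq_zero_of_neg (hfc : ContinuousOn f (Metric.closedBall 0 1))
    (hfd : DifferentiableOn ℂ f (Metric.ball 0 1)) {k : ℤ} (hk : k < 0) : sharp f k = 0 := by
  have hk' : (0 : ℝ) < -k := by
    have : (k : ℝ) < 0 := by exact_mod_cast hk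
    linarith
  -- The kernel e^{-kw} is entire and 2πi-periodic, so it has neither poles nor a jump; k < 0 gives
  -- decay.
  have key := integral_circle_mul_eq hfc hfd (M := fun w => exp (-(k * w))) (r := fun _ => 0)
    (J := fun _ => 0) (S := ∅) (δ := -k) (C := 1) hk' (by simp)
    (fun w _ _ _ => by fun_prop) (by simp) (Eventually.of_forall fun R y => ?_) ?_ (by simp)
  · rw [sharp_eq]
    simp only [ofReal_intCast]
    rw [key]
    simp
  · rw [norm_exp, one_mul]
    apply le_of_eq
    simp
  · intro t _
    have : exp (-(k * (Real.log t + π * I))) = exp (-(k * (Real.log t + (-π : ℝ) * I))) := by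
      rw [exp_eq_exp_iff_exists_int]
      refine ⟨-k, ?_⟩
      push_cast
      ring
    rw [this]
    simp

theorem exp_natCast_periodic (f : ℂ → ℂ) (n : ℕ) :
    Function.Periodic (fun y : ℝ => f (exp (y * I)) * exp (-((n : ℝ) * (y * I)))) (2 * π) := by
  intro y
  have e1 : exp ((y + 2 * π : ℝ) * I) = exp (y * I) := by
    rw [exp_eq_exp_iff_exists_int]
    exact ⟨1, by push_cast; ring⟩
  have e2 : exp (-((n : ℝ) * ((y + 2 * π : ℝ) * I))) = exp (-((n : ℝ) * (y * I))) := by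
    rw [exp_eq_exp_iff_exists_int]
    exact ⟨-n, by push_cast; ring⟩
  simp only [e1, e2]

/-- At natural numbers, `sharp` gives the Taylor coefficients. -/
theorem hasSum_sharp_mul_pow (hfc : ContinuousOn f (Metric.closedBall 0 1))
    (hfd : DifferentiableOn ℂ f (Metric.ball 0 1)) {z : ℂ} (hz : ‖z‖ < 1) :
    HasSum (fun n : ℕ => sharp f n * z ^ n) (f z) := by
  have hci : CircleIntegrable f 0 1 :=
    (hfc.mono Metric.sphere_subset_closedBall).circleIntegrable zero_le_one
  have h := hasSum_cauchyPowerSeries_integral (c := 0) hci hz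
  have hcauchy := two_pi_I_inv_smul_circleIntegral_sub_inv_smul_of_differentiable_on_off_countable
    (c := 0) (R := 1) (w := z) countable_empty (by simpa using hz) hfc
    (fun x hx => hfd.differentiableAt (Metric.isOpen_ball.mem_nhds hx.1))
  rw [zero_add, hcauchy] at h
  refine hasSum_of_eq h fun n => ?_
  rw [cauchyPowerSeries_apply, sharp_eq]
  -- Cauchy's formula integrates over [0, 2π], `sharp` over [-π, π]; periodicity at integer
  -- frequency reconciles them.
  have hper := (exp_natCast_periodic f n).intervalIntegral_add_eq (-π) 0
  rw [show -π + 2 * π = π by ring, zero_add] at hper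
  simp only [ofReal_natCast] at hper ⊢
  have hint : ∀ θ : ℝ, deriv (circleMap 0 1) θ • (z / (circleMap 0 1 θ - 0)) ^ n •
      (circleMap 0 1 θ - 0)⁻¹ • f (circleMap 0 1 θ) =
      I * z ^ n * (f (exp (θ * I)) * exp (-(n * (θ * I)))) := by
    intro θ
    have h0 := exp_ne_zero (θ * I)
    have hc : circleMap 0 1 θ = exp (θ * I) := by simp [circleMap]
    rw [deriv_circleMap, hc, sub_zero, exp_neg, exp_nat_mul, div_pow]
    simp only [smul_eq_mul]
    field_simp
  rw [hper, circleIntegral, smul_eq_mul]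
  simp only [hint]
  rw [intervalIntegral.integral_const_mul, mul_inv _ I]
  linear_combination (-(2 * π : ℂ)⁻¹ * z ^ n * ∫ y : ℝ in 0..2 * π,
    f (exp (y * I)) * exp (-(n * (y * I)))) * inv_mul_cancel₀ I_ne_zero

theorem mem_K_natCast {N : ℕ} {ω : ℂ} : ω ∈ K (N : ℝ) ↔ ω ^ N = 1 := by
  change ω ^ (((N : ℝ)) : ℂ) = 1 ↔ _
  rw [ofReal_natCast, cpow_natCast]

theorem sum_pow_K {N : ℕ} (hN : 0 < (N : ℝ)) (n : ℕ) :
    ∑ ω ∈ (K_finite hN).toFinset, ω ^ n = if N ∣ n then (N : ℂ) else 0 := by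
  have hN' : 0 < N := by exact_mod_cast hN
  have hK : (K_finite hN).toFinset = Polynomial.nthRootsFinset N (1 : ℂ) := by
    ext ω
    rw [Set.Finite.mem_toFinset, mem_K_natCast, Polynomial.mem_nthRootsFinset hN']
  have hζ := isPrimitiveRoot_exp N hN'.ne'
  rw [hK]
  split_ifs with h
  · obtain ⟨k, rfl⟩ := h
    have : ∀ ω ∈ Polynomial.nthRootsFinset N (1 : ℂ), ω ^ (N * k) = 1 := fun ω hω => by
      rw [pow_mul, (Polynomial.mem_nthRootsFinset hN' _).1 hω, one_pow]
    rw [Finset.sum_congr rfl this]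
    simp [hζ.card_nthRootsFinset]
  · set ζ := exp (2 * π * I / N)
    have hne : ζ ^ n ≠ 1 := fun he => h ((hζ.pow_eq_one_iff_dvd n).1 he)
    have hζ0 : ζ ≠ 0 := exp_ne_zero _
    -- Multiplication by ζ permutes the roots, so the sum is fixed by the factor ζ^n ≠ 1 and must
    -- vanish.
    have hmul : ∑ ω ∈ Polynomial.nthRootsFinset N (1 : ℂ), ω ^ n =
        ζ ^ n * ∑ ω ∈ Polynomial.nthRootsFinset N (1 : ℂ), ω ^ n := by
      rw [Finset.mul_sum]
      symm
      apply Finset.sum_bij (fun ω _ => ζ * ω)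
      · intro ω hω
        rw [Polynomial.mem_nthRootsFinset hN'] at hω ⊢
        rw [mul_pow, hω, hζ.pow_eq_one, mul_one]
      · intro a _ b _ hab
        exact mul_left_cancel₀ hζ0 hab
      · intro ω hω
        rw [Polynomial.mem_nthRootsFinset hN'] at hω
        refine ⟨ζ⁻¹ * ω, ?_, by rw [mul_inv_cancel_left₀ hζ0]⟩
        rw [Polynomial.mem_nthRootsFinset hN', mul_pow, inv_pow, hω, hζ.pow_eq_one]
        simp
      · intro ω _
        rw [mul_pow]
    have h0 : (1 - ζ ^ n) * ∑ ω ∈ Polynomial.nthRootsFinset N (1 : ℂ), ω ^ n = 0 := by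
      linear_combination hmul
    exact (mul_eq_zero.1 h0).resolve_left (sub_ne_zero.2 hne.symm)

/-- Adding the Taylor series at the points lω over all N-th roots of unity ω leaves only the
exponents divisible by N, each with weight N. -/
theorem hasSum_pos_natCast (hfc : ContinuousOn f (Metric.closedBall 0 1))
    (hfd : DifferentiableOn ℂ f (Metric.ball 0 1)) {N : ℕ} (hN : 0 < (N : ℝ)) (hl : 0 < l)
    (hl1 : l < 1) :
    HasSum (fun j : ℕ => ((N : ℝ) : ℂ) * (sharp f (N * j + 0) * ((l ^ ((N : ℝ) * j) : ℝ) : ℂ)))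
      (rootSum f hN 0 l) := by
  have hN' : 0 < N := by exact_mod_cast hN
  have h : HasSum (fun n : ℕ => ∑ ω ∈ (K_finite hN).toFinset, sharp f n * (l * ω) ^ n)
      (∑ ω ∈ (K_finite hN).toFinset, f (l * ω)) := by
    refine hasSum_sum fun ω hω => hasSum_sharp_mul_pow hfc hfd ?_
    rw [norm_mul, norm_of_mem_K hN ((K_finite hN).mem_toFinset.1 hω), mul_one, norm_real,
      Real.norm_of_nonneg hl.le]
    exact hl1
  have hterm : ∀ n : ℕ, ∑ ω ∈ (K_finite hN).toFinset, sharp f n * (l * ω) ^ n =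
      sharp f n * l ^ n * if N ∣ n then (N : ℂ) else 0 := by
    intro n
    rw [← sum_pow_K hN, Finset.mul_sum]
    refine Finset.sum_congr rfl fun ω _ => ?_
    rw [mul_pow, mul_assoc]
  simp only [hterm] at h
  have hinj : Function.Injective fun j : ℕ => N * j := fun a b hab =>
    Nat.eq_of_mul_eq_mul_left hN' hab
  rw [← hinj.hasSum_iff] at h
  · have hroot : rootSum f hN 0 l = ∑ ω ∈ (K_finite hN).toFinset, f (l * ω) := by
      simp [rootSum]
    rw [hroot]
    refine hasSum_of_eq h fun j => ?_
    simp only [Function.comp_apply, dvd_mul_right, if_true]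
    rw [add_zero, ← Nat.cast_mul, Real.rpow_natCast]
    push_cast
    ring
  · intro n hn
    rw [if_neg, mul_zero]
    rintro ⟨k, rfl⟩
    exact hn ⟨k, rfl⟩

end FractionalTaylor

theorem theorem3p1 (f : ℂ → ℂ)
    (hfc : ContinuousOn f (Metric.closedBall 0 1))
    (hfd : DifferentiableOn ℂ f (Metric.ball 0 1))
    (α γ : ℝ) (hα : 0 < α) (hγ : γ < α) :
    -- the case `α / 2 ∉ ℕ`
    ((¬ ∃ m : ℕ, α / 2 = m) →
      (∀ lam : ℝ, 0 < lam →
        (lam < 1 ∨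
          (lam = 1 ∧ Summable (fun j : ℤ => ‖FractionalTaylor.sharp f (α * j + γ)‖))) →
        IntervalIntegrable (FractionalTaylor.integrandPos f α γ lam) MeasureTheory.volume 0 1 ∧
        IntervalIntegrable (FractionalTaylor.integrandNeg f α γ lam) MeasureTheory.volume 0 1 ∧
        IntervalIntegrable (FractionalTaylor.integrandTotal f α γ lam) MeasureTheory.volume 0 1 ∧
        HasSum
          (fun j : ℕ => (α : ℂ) *
            (FractionalTaylor.sharp f (α * j + γ) * ((lam ^ (α * j) : ℝ) : ℂ)))
          (FractionalTaylor.rootSum f hα γ lam -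
            ((α / Real.pi : ℝ) : ℂ) *
              ∫ t in (0 : ℝ)..1, FractionalTaylor.integrandPos f α γ lam t) ∧
        HasSum
          (fun j : {j : ℤ // j ≤ -1} => (α : ℂ) *
            (FractionalTaylor.sharp f (α * (j : ℤ) + γ) *
              ((lam ^ (-(α * (j : ℤ))) : ℝ) : ℂ)))
          (((α * lam ^ α / Real.pi : ℝ) : ℂ) *
            ∫ t in (0 : ℝ)..1, FractionalTaylor.integrandNeg f α γ lam t) ∧
        HasSum
          (fun j : ℤ => (α : ℂ) *
            (FractionalTaylor.sharp f (α * j + γ) * ((lam ^ (α * |(j : ℝ)|) : ℝ) : ℂ)))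
          (FractionalTaylor.rootSum f hα γ lam -
            ((α * (1 - lam ^ (2 * α)) / Real.pi : ℝ) : ℂ) *
              ∫ t in (0 : ℝ)..1, FractionalTaylor.integrandTotal f α γ lam t)) ∧
      (Summable (fun j : ℤ => ‖FractionalTaylor.sharp f (α * j + γ)‖) →
        HasSum (fun j : ℤ => (α : ℂ) * FractionalTaylor.sharp f (α * j + γ))
          (∑ ω ∈ (FractionalTaylor.K_finite hα).toFinset, ω ^ (-γ : ℂ) * f ω))) ∧
    -- the case `α / 2 ∈ ℕ`, `γ = 0`
    ((∃ m : ℕ, α / 2 = m) → γ = 0 →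
      (∀ lam : ℝ, 0 < lam →
        (lam < 1 ∨
          (lam = 1 ∧ Summable (fun j : ℤ => ‖FractionalTaylor.sharp f (α * j + γ)‖))) →
        HasSum
          (fun j : ℕ => (α : ℂ) *
            (FractionalTaylor.sharp f (α * j + γ) * ((lam ^ (α * j) : ℝ) : ℂ)))
          (FractionalTaylor.rootSum f hα γ lam) ∧
        HasSum
          (fun j : {j : ℤ // j ≤ -1} => (α : ℂ) *
            (FractionalTaylor.sharp f (α * (j : ℤ) + γ) *
              ((lam ^ (-(α * (j : ℤ))) : ℝ) : ℂ)))
          0 ∧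
        HasSum
          (fun j : ℤ => (α : ℂ) *
            (FractionalTaylor.sharp f (α * j + γ) * ((lam ^ (α * |(j : ℝ)|) : ℝ) : ℂ)))
          (FractionalTaylor.rootSum f hα γ lam)) ∧
      (Summable (fun j : ℤ => ‖FractionalTaylor.sharp f (α * j + γ)‖) →
        HasSum (fun j : ℤ => (α : ℂ) * FractionalTaylor.sharp f (α * j + γ))
          (∑ ω ∈ (FractionalTaylor.K_finite hα).toFinset, ω ^ (-γ : ℂ) * f ω))) := by
  constructor
  · intro hα2
    have main : ∀ lam : ℝ, 0 < lam →
        (lam < 1 ∨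
          (lam = 1 ∧ Summable (fun j : ℤ => ‖FractionalTaylor.sharp f (α * j + γ)‖))) →
        lam ≤ 1 ∧ HasSum
          (fun j : ℕ => (α : ℂ) *
            (FractionalTaylor.sharp f (α * j + γ) * ((lam ^ (α * j) : ℝ) : ℂ)))
          (FractionalTaylor.rootSum f hα γ lam -
            ((α / Real.pi : ℝ) : ℂ) *
              ∫ t in (0 : ℝ)..1, FractionalTaylor.integrandPos f α γ lam t) ∧
        HasSum (fun n : ℕ => (α : ℂ) * (FractionalTaylor.sharp f (α * (-(n + 1) : ℤ) + γ) *
            ((lam ^ (-(α * (-(n + 1) : ℤ))) : ℝ) : ℂ)))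
          (((α * lam ^ α / Real.pi : ℝ) : ℂ) *
            ∫ t in (0 : ℝ)..1, FractionalTaylor.integrandNeg f α γ lam t) := by
      rintro lam hl (hl1 | ⟨rfl, hs⟩)
      · exact ⟨hl1.le, FractionalTaylor.hasSum_pos hfc hfd hα hγ hα2 hl hl1,
          FractionalTaylor.hasSum_neg hfc hfd hα hγ hα2 hl hl1⟩
      · exact ⟨le_rfl, FractionalTaylor.hasSum_pos_one hfc hfd hα hγ hα2 hs,
          FractionalTaylor.hasSum_neg_one hfc hfd hα hγ hα2 hs⟩
    have total : ∀ lam : ℝ, 0 < lam →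
        (lam < 1 ∨
          (lam = 1 ∧ Summable (fun j : ℤ => ‖FractionalTaylor.sharp f (α * j + γ)‖))) →
        HasSum
          (fun j : ℤ => (α : ℂ) *
            (FractionalTaylor.sharp f (α * j + γ) * ((lam ^ (α * |(j : ℝ)|) : ℝ) : ℂ)))
          (FractionalTaylor.rootSum f hα γ lam -
            ((α * (1 - lam ^ (2 * α)) / Real.pi : ℝ) : ℂ) *
              ∫ t in (0 : ℝ)..1, FractionalTaylor.integrandTotal f α γ lam t) := by
      intro lam hl hlam
      obtain ⟨hl1, hp, hn⟩ := main lam hl hlam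
      have h := FractionalTaylor.hasSum_abs
        (s := fun j : ℤ => FractionalTaylor.sharp f (α * j + γ)) (l := lam) (by simpa using hp) hn
      have e := FractionalTaylor.integral_integrandTotal hfc hα hγ hα2 ⟨hl, hl1⟩
      convert h using 1
      push_cast at e ⊢
      linear_combination (α / Real.pi : ℂ) * e
    refine ⟨fun lam hl hlam => ?_, fun hs => ?_⟩
    · obtain ⟨hl1, hp, hn⟩ := main lam hl hlam
      exact ⟨FractionalTaylor.intervalIntegrable_integrandPos hfc hα hγ hα2 ⟨hl, hl1⟩,
        FractionalTaylor.intervalIntegrable_integrandNeg hfc hα hγ hα2 ⟨hl, hl1⟩,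
        FractionalTaylor.intervalIntegrable_integrandTotal hfc hα hγ hα2 ⟨hl, hl1⟩, hp,
        FractionalTaylor.hasSum_le_neg_one_iff (u := fun j : ℤ => (α : ℂ) *
          (FractionalTaylor.sharp f (α * j + γ) * ((lam ^ (-(α * j)) : ℝ) : ℂ))) |>.1 hn,
        total lam hl hlam⟩
    -- At λ = 1 the coefficient 1 - λ^{2α} of the integral vanishes.
    · simpa [FractionalTaylor.rootSum] using total 1 one_pos (Or.inr ⟨rfl, hs⟩)
  · rintro ⟨m, hm⟩ rfl
    obtain ⟨N, rfl⟩ : ∃ N : ℕ, α = N := ⟨2 * m, by push_cast; linarith⟩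
    have hN : 0 < N := by exact_mod_cast hα
    have hzero : ∀ j : ℤ, j ≤ -1 → FractionalTaylor.sharp f (N * j + 0) = 0 := by
      intro j hj
      have h := FractionalTaylor.sharp_eq_zero_of_neg hfc hfd (k := N * j)
        (mul_neg_of_pos_of_neg (by exact_mod_cast hN) (by omega))
      rw [add_zero]
      exact_mod_cast h
    have hneg : ∀ lam : ℝ, HasSum
          (fun j : {j : ℤ // j ≤ -1} => ((N : ℝ) : ℂ) *
            (FractionalTaylor.sharp f (N * (j : ℤ) + 0) *
              ((lam ^ (-((N : ℝ) * (j : ℤ))) : ℝ) : ℂ))) 0 := by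
      intro lam
      refine FractionalTaylor.hasSum_of_eq hasSum_zero fun j => ?_
      rw [hzero j j.2, zero_mul, mul_zero]
    have hpos : ∀ lam : ℝ, 0 < lam →
        (lam < 1 ∨
          (lam = 1 ∧ Summable (fun j : ℤ => ‖FractionalTaylor.sharp f (N * j + 0)‖))) →
        HasSum (fun j : ℕ => ((N : ℝ) : ℂ) *
            (FractionalTaylor.sharp f (N * j + 0) * ((lam ^ ((N : ℝ) * j) : ℝ) : ℂ)))
          (FractionalTaylor.rootSum f hα 0 lam) := by
      rintro lam hl (hl1 | ⟨rfl, hs⟩)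
      · exact FractionalTaylor.hasSum_pos_natCast hfc hfd hα hl hl1
      · refine FractionalTaylor.hasSum_one_of_tendsto
          (a := fun j : ℕ => FractionalTaylor.sharp f (N * j + 0)) (e := fun j => (N : ℝ) * j)
          (F := FractionalTaylor.rootSum f hα 0) (fun n => by positivity) ?_
          (fun l hl hl1 => FractionalTaylor.hasSum_pos_natCast hfc hfd hα hl hl1)
          (FractionalTaylor.tendsto_rootSum hfc hα 0)
        simpa [Function.comp_def] using hs.comp_injective (i := ((↑) : ℕ → ℤ)) Nat.cast_injective
    have total : ∀ lam : ℝ, 0 < lam →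
        (lam < 1 ∨
          (lam = 1 ∧ Summable (fun j : ℤ => ‖FractionalTaylor.sharp f (N * j + 0)‖))) →
        HasSum (fun j : ℤ => ((N : ℝ) : ℂ) *
            (FractionalTaylor.sharp f (N * j + 0) * ((lam ^ ((N : ℝ) * |(j : ℝ)|) : ℝ) : ℂ)))
          (FractionalTaylor.rootSum f hα 0 lam) := by
      intro lam hl hlam
      have h := FractionalTaylor.hasSum_abs
        (s := fun j : ℤ => FractionalTaylor.sharp f (N * j + 0)) (l := lam)
        (by simpa using hpos lam hl hlam)
        (FractionalTaylor.hasSum_le_neg_one_iff (u := fun j : ℤ => ((N : ℝ) : ℂ) *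
          (FractionalTaylor.sharp f (N * j + 0) *
            ((lam ^ (-((N : ℝ) * j)) : ℝ) : ℂ))) |>.2 (hneg lam))
      rwa [add_zero] at h
    refine ⟨fun lam hl hlam => ⟨hpos lam hl hlam, hneg lam, total lam hl hlam⟩, fun hs => ?_⟩
    simpa [FractionalTaylor.rootSum] using total 1 one_pos (Or.inr ⟨rfl, hs⟩)
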